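/- Let $(V,\otimes,k)$ be a commutative quantale (a complete lattice with a commutative monoid structure preserving suprema in each variable), with internal hom $[-,-]$. **Terminology.** A $V$-category $(X,a)$ is a set with $a:X\times X\to V$ such that $k\le a(x,x)$ and $a(x,y)\otimes a(y,z)\le a(x,z)$; write $x\le y$ for $k\le a(x,y)$. An $(L,V)$-category is a set $X$ with $a: LX\times X\to V$ ($LX$ = finite lists in $X$) such that $k\le a((x),x)$ and $a(\underline{x}_1,y_1)\otimes\dots\otimes a(\underline{x}_n,y_n)\otimes a((y_1,\dots,y_n),z)\le a((\underline{x}_1;\dots;\underline{x}_n),z)$. An $(L,V)$-functor $f$ satisfies $a(\underline{x},y)\le b(Lf(\underline{x}),f(y))$, and is fully faithful if equality holds. A promonoidal $V$-category is a $V$-category with distributors $P:X\boxtimes X\to X$, $J:1\to X$ forming a monoid in $V$-distributors; it is an $(L,V)$-category via $a_0=J$, $a_1=a$, $a_2=P$, $a_n=P\cdot(\mathrm{Id}\boxtimes a_{n-1})$. A $V$-quantum B-algebra is a promonoidal $V$-category with operations $\rhd,\lhd$ and an element $u$ such that $P(x,-,y)=a(-,x\lhd y)$, $P(-,x,y)=a(-,x\rhd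 y)$, $J=a(u,-)$; a morphism of $V$-quantum B-algebras is a $V$-functor with $f(x\rhd y)\le f(x)\rhd f(y)$, $f(x\lhd y)\le f(x)\lhd f(y)$ and $u\le f(u)$. A $V$-quantale is a separated cocomplete monoidal $V$-category $(Q,*,k_Q)$ whose multiplication is cocontinuous in each variable; it is a $V$-quantum B-algebra through its residuals and an $(L,V)$-category via $Q((q_1,\dots,q_n),q)=Q(q_1*\dots*q_n,q)$. A fully faithful $(L,V)$-functor $i:X\to Q$ into a $V$-quantale is dense if every $q\in Q$ is the $V$-limit of $i$ weighted by $x\mapsto Q(q,i(x))$ and the $(L,V)$-colimit of $i$ weighted by $\underline{x}\mapsto Q(Li(\underline{x}),q)$. A lax monoidal monad on $Q$ is a $V$-functor $T:Q\to Q$ with $q\le T(q)$, $k_Q\le T(k_Q)$, $T(q)*T(r)\le T(q*r)$ and $T^2=T$; its fixed points $Q^T$ form a $V$-quantale with the induced $V$-structure, multiplication $T(q*r)$ and unit $T(k_Q)$. For an $(L,V)$-category $(X,a)$, $\mathbb D_L(X)$ is the $V$-quantale of $(L,V)$-presheaves on $X$, i.e. of functions $\varphi:LX\to V$ with $a(\underline{x}_1,y_1)\otimes\dots\otimes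 a(\underline{x}_n,y_n)\otimes\varphi(y_1,\dots,y_n)\le\varphi(\underline{x}_1;\dots;\underline{x}_n)$, with $\mathbb D_L(X)(\varphi,\psi)=\bigwedge_{\underline{x}}[\varphi(\underline{x}),\psi(\underline{x})]$ and convolution $(\varphi*\psi)(\underline{x})=\bigvee_{(\underline{y};\underline{z})=\underline{x}}\varphi(\underline{y})\otimes\psi(\underline{z})$ as multiplication; the Yoneda embedding is $y:X\to\mathbb D_L(X)$, $x\mapsto a(-,x)$. In a category with a class of fully faithful morphisms, an object $E$ is injective if morphisms into $E$ extend (strictly) along fully faithful morphisms; a morphism $e:X\to E$ is essential if $fe$ fully faithful implies $f$ fully faithful; an injective hull of $X$ is an injective $E$ with a fully faithful essential $e:X\to E$. **Statement.** Let $X$ be a $V$-quantum B-algebra. There is a map $T:\mathbb D_L(X)\to\mathbb D_L(X)$ such that $T(\varphi)$ is the $V$-limit of $y$ weighted by $x\mapsto\mathbb D_L(X)(\varphi,y(x))$ for every $\varphi$, and $T$ is a lax monoidal monad. The Yoneda embedding takes values in the $V$-quantale $\mathbb D_L(X)^T$ of fixed points of $T$, and the resulting map $i:X\to\mathbb D_L(X)^T$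 is a morphism of $V$-quantum B-algebras and is dense; thus every $V$-quantum B-algebra admits a dense morphism into a $V$-quantale. Moreover $i$ exhibits $\mathbb D_L(X)^T$ as an injective hull of $X$, both in the category of $(L,V)$-categories and in the category of $V$-quantum B-algebras, with respect to fully faithful $(L,V)$-functors. -/

import Mathlib

universe u v v' w w₁ w₂ w₃

namespace QEnr

section Relations

variable {V : Type u} [CommMonoid V] [CompleteLattice V] [IsQuantale V]

/-- The internal hom `[a, b]` of the commutative quantale `V`. -/
def ihom (a b : V) : V := Quantale.rightMulResiduation a b

theorem le_ihom {a b c : V} : c ≤ ihom a b ↔ a * c ≤ b :=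
  Quantale.rightMulResiduation_le_iff_mul_le

/-- The composite `s · r` of the `V`-relations `r : X ⇸ Y` and `s : Y ⇸ Z`. -/
def relComp {X : Type v} {Y : Type v'} {Z : Type w} (r : X → Y → V) (s : Y → Z → V) :
    X → Z → V :=
  fun x z => ⨆ y, r x y * s y z

/-- The extension `L r : L X ⇸ L Y` of the list monad to a `V`-relation `r : X ⇸ Y`. -/
def listExt {X : Type v} {Y : Type v'} (r : X → Y → V) : List X → List Y → V
  | [], [] => 1
  | x :: xs, y :: ys => r x y * listExt r xs ys
  | _, _ => ⊥

/-- `L r · m°`, for an `(L,V)`-relation `r : L X ⇸ Y` and the multiplication `m : L L X → L X`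
(concatenation) of the list monad. -/
def listHat {X : Type v} {Y : Type v'} (r : List X → Y → V) : List X → List Y → V :=
  fun xs ys => ⨆ (xss : List (List X)) (_ : xss.flatten = xs), listExt r xss ys

/-- The Kleisli composite `s ∘ r = s · L r · m°` of the `(L,V)`-relations `r : L X ⇸ Y`
and `s : L Y ⇸ Z`. -/
def kleisliComp {X : Type v} {Y : Type v'} {Z : Type w} (r : List X → Y → V)
    (s : List Y → Z → V) : List X → Z → V :=
  relComp (listHat r) s

end Relations

section Definitions

variable (V : Type u) [CommMonoid V] [CompleteLattice V] [IsQuantale V]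

/-- A `V`-category structure on `X`. -/
structure VCat (X : Type v) where
  hom : X → X → V
  one_le : ∀ x, 1 ≤ hom x x
  comp : ∀ x y z, hom x y * hom y z ≤ hom x z

/-- An `(L,V)`-category structure on `X`: `e° ≤ a` and `a ∘ a ≤ a`. -/
structure LVCat (X : Type v) where
  hom : List X → X → V
  one_le : ∀ x, 1 ≤ hom [x] x
  comp : ∀ xs z, kleisliComp hom hom xs z ≤ hom xs z

/-- The one-point `V`-category `K = (1, k)`. -/
def VCat.point : VCat V PUnit.{w + 1} where
  hom _ _ := 1
  one_le _ := le_rfl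
  comp _ _ _ := by simp

variable {V}

/-- The tensor product `X ⊠ Y` of two `V`-categories. -/
def VCat.tensor {X : Type v} {Y : Type v'} (A : VCat V X) (B : VCat V Y) : VCat V (X × Y) where
  hom p q := A.hom p.1 q.1 * B.hom p.2 q.2
  one_le p := by simpa using mul_le_mul' (A.one_le p.1) (B.one_le p.2)
  comp p q r := by
    rw [mul_mul_mul_comm]
    exact mul_le_mul' (A.comp _ _ _) (B.comp _ _ _)

/-- `V`-functors. -/
def IsVFunctor {X : Type v} {Y : Type v'} (A : VCat V X) (B : VCat V Y) (f : X → Y) : Prop :=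
  ∀ x y, A.hom x y ≤ B.hom (f x) (f y)

/-- `V`-distributors `X ⇸ Y`. -/
def IsVDistributor {X : Type v} {Y : Type v'} (A : VCat V X) (B : VCat V Y)
    (j : X → Y → V) : Prop :=
  (∀ x y, relComp A.hom j x y ≤ j x y) ∧ (∀ x y, relComp j B.hom x y ≤ j x y)

/-- `g : Z → Y` is the colimit of `f : X → Y` weighted by `j : X ⇸ Z`. -/
def IsColimit {X : Type v} {Y : Type v'} {Z : Type w} (C : VCat V Z) (B : VCat V Y)
    (j : X → Z → V) (f : X → Y) (g : Z → Y) : Prop :=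
  IsVFunctor C B g ∧ ∀ z y, B.hom (g z) y = ⨅ x, ihom (j x z) (B.hom (f x) y)

/-- `h : Z → Y` is the limit of `f : X → Y` weighted by `l : Z ⇸ X`. -/
def IsLimit {X : Type v} {Y : Type v'} {Z : Type w} (C : VCat V Z) (B : VCat V Y)
    (l : Z → X → V) (f : X → Y) (h : Z → Y) : Prop :=
  IsVFunctor C B h ∧ ∀ y z, B.hom y (h z) = ⨅ x, ihom (l z x) (B.hom y (f x))

/-- Existence of all weighted colimits (with small weights). -/
def IsCocomplete {Y : Type v} (B : VCat V Y) : Prop :=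
  ∀ (X Z : Type v) (A : VCat V X) (C : VCat V Z) (j : X → Z → V) (f : X → Y),
    IsVDistributor A C j → IsVFunctor A B f → ∃ g : Z → Y, IsColimit C B j f g

/-- `V`-functors preserving all weighted colimits that exist. -/
def IsCocontinuous {Y : Type v} {W : Type v} (B : VCat V Y) (D : VCat V W) (h : Y → W) : Prop :=
  IsVFunctor B D h ∧
  ∀ (X Z : Type v) (A : VCat V X) (C : VCat V Z) (j : X → Z → V) (f : X → Y) (g : Z → Y),
    IsVDistributor A C j → IsVFunctor A B f → IsColimit C B j f g →
      IsColimit C D j (fun x => h (f x)) (fun z => h (g z))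

/-- Separated `V`-categories. -/
def IsSeparated {X : Type v} (A : VCat V X) : Prop :=
  ∀ x y, 1 ≤ A.hom x y → 1 ≤ A.hom y x → x = y

/-- The distributor `f_* : X ⇸ Y` of a `V`-functor `f : X → Y`. -/
def lowerStar {X : Type v} {Y : Type v'} (B : VCat V Y) (f : X → Y) : X → Y → V :=
  fun x y => B.hom (f x) y

/-- The distributor `f^* : Y ⇸ X` of a `V`-functor `f : X → Y`. -/
def upperStar {X : Type v} {Y : Type v'} (B : VCat V Y) (f : X → Y) : Y → X → V :=
  fun y x => B.hom y (f x)

/-! ### `(L,V)`-categories -/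

/-- `(L,V)`-functors. -/
def IsLVFunctor {X : Type v} {Y : Type v'} (A : LVCat V X) (B : LVCat V Y) (f : X → Y) : Prop :=
  ∀ xs y, A.hom xs y ≤ B.hom (xs.map f) (f y)

/-- Fully faithful `(L,V)`-functors. -/
def IsFullyFaithful {X : Type v} {Y : Type v'} (A : LVCat V X) (B : LVCat V Y)
    (f : X → Y) : Prop :=
  ∀ xs y, A.hom xs y = B.hom (xs.map f) (f y)

/-- The `(L,V)`-distributor `f_⊛ : L X ⇸ Y` of an `(L,V)`-functor `f : X → Y`. -/
def lowerLStar {X : Type v} {Y : Type v'} (B : LVCat V Y) (f : X → Y) : List X → Y → V :=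
  fun xs y => B.hom (xs.map f) y

/-- The `(L,V)`-distributor `f^⊛ : L Y ⇸ X` of an `(L,V)`-functor `f : X → Y`. -/
def upperLStar {X : Type v} {Y : Type v'} (B : LVCat V Y) (f : X → Y) : List Y → X → V :=
  fun ys x => B.hom ys (f x)

/-- `g : Z → Y` is the `(L,V)`-colimit of `f : X → Y` weighted by `j : L X ⇸ Z`. -/
def IsLColimit {X : Type v} {Y : Type v'} {Z : Type w} (C : LVCat V Z) (B : LVCat V Y)
    (j : List X → Z → V) (f : X → Y) (g : Z → Y) : Prop :=
  IsLVFunctor C B g ∧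
  ∀ (zs : List Z) (y : Y),
    lowerLStar B g zs y = ⨅ xs : List X, ihom (listHat j xs zs) (lowerLStar B f xs y)

end Definitions

section BasicLemmas

variable {V : Type u} [CommMonoid V] [CompleteLattice V] [IsQuantale V]

theorem mul_iSup' {ι : Sort*} (a : V) (f : ι → V) : a * (⨆ i, f i) = ⨆ i, a * f i := by
  rw [iSup, mul_sSup_distrib, iSup_range]

theorem iSup_mul' {ι : Sort*} (a : V) (f : ι → V) : (⨆ i, f i) * a = ⨆ i, f i * a := by
  rw [iSup, sSup_mul_distrib, iSup_range]

theorem kleisliComp_le_iff {X : Type v} {Y : Type v'} {Z : Type w} {r : List X → Y → V}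
    {s : List Y → Z → V} {t : List X → Z → V} :
    (∀ xs z, kleisliComp r s xs z ≤ t xs z) ↔
      ∀ xss ys z, listExt r xss ys * s ys z ≤ t xss.flatten z := by
  simp only [kleisliComp, relComp, listHat, iSup_mul', iSup_le_iff]
  constructor
  · intro h xss ys z
    exact h _ z ys xss rfl
  · rintro h _ z ys xss rfl
    exact h xss ys z

theorem LVCat.comp' {X : Type v} (A : LVCat V X) (xss : List (List X)) (ys : List X) (z : X) :
    listExt A.hom xss ys * A.hom ys z ≤ A.hom xss.flatten z :=
  kleisliComp_le_iff.1 A.comp xss ys z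

theorem listExt_append_right {X : Type v} {Y : Type v'} (r : X → Y → V) (p q : List Y) :
    ∀ xs : List X, listExt r xs (p ++ q) =
      listExt r (xs.take p.length) p * listExt r (xs.drop p.length) q := by
  induction p with
  | nil => intro xs; simp [listExt]
  | cons y p ih =>
    intro xs
    cases xs with
    | nil => simp [listExt, Quantale.bot_mul]
    | cons x xs => simp [listExt, ih, mul_assoc]

theorem listExt_append {X : Type v} {Y : Type v'} (r : X → Y → V) (p : List Y) (q : List Y)
    (ys : List X) : ∀ xs : List X, listExt r xs p * listExt r ys q ≤
      listExt r (xs ++ ys) (p ++ q) := by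
  induction p with
  | nil =>
    intro xs
    cases xs <;> simp [listExt, Quantale.bot_mul]
  | cons y p ih =>
    intro xs
    cases xs with
    | nil => simp [listExt, Quantale.bot_mul]
    | cons x xs =>
      simp only [listExt, List.cons_append, mul_assoc]
      exact mul_le_mul_right (ih xs) _

theorem flatten_map_singleton {X : Type v} (xs : List X) : (xs.map fun x => [x]).flatten = xs := by
  induction xs with
  | nil => rfl
  | cons x xs ih => simp only [List.map_cons, List.flatten_cons, ih, List.singleton_append]

theorem LVCat.one_le_listExt {X : Type v} (A : LVCat V X) (xs : List X) :
    1 ≤ listExt A.hom (xs.map fun x => [x]) xs := by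
  induction xs with
  | nil => simp [listExt]
  | cons x xs ih => simpa [listExt] using mul_le_mul' (A.one_le x) ih

/-- The one-point `(L,V)`-category `E = (1, e°)`. -/
def LVCat.point (V : Type u) [CommMonoid V] [CompleteLattice V] [IsQuantale V] :
    LVCat V PUnit.{w + 1} where
  hom
    | [_], _ => 1
    | _, _ => ⊥
  one_le _ := le_rfl
  comp := by
    rw [kleisliComp_le_iff]
    intro xss ys z
    match ys with
    | [] => simp [Quantale.mul_bot]
    | _ :: _ :: _ => simp [Quantale.mul_bot]
    | [y] =>
      match xss with
      | [] => simp [listExt]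
      | [xs] => simp [listExt]
      | _ :: _ :: _ => simp [listExt, Quantale.mul_bot]

/-- The underlying `V`-category of an `(L,V)`-category. -/
def LVCat.toVCat {X : Type v} (A : LVCat V X) : VCat V X where
  hom x y := A.hom [x] y
  one_le := A.one_le
  comp x y z := by simpa [listExt] using A.comp' [[x]] [y] z

end BasicLemmas

section Monoidal

variable (V : Type u) [CommMonoid V] [CompleteLattice V] [IsQuantale V]

/-- Monoidal `V`-categories. -/
structure MonoidalVCat (X : Type v) extends VCat V X where
  mul : X → X → X
  unit : X
  mul_functor : IsVFunctor (toVCat.tensor toVCat) toVCat (fun p => mul p.1 p.2)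
  mul_assoc : ∀ x y z, mul (mul x y) z = mul x (mul y z)
  unit_mul : ∀ x, mul unit x = x
  mul_unit : ∀ x, mul x unit = x

/-- `V`-quantales: separated cocomplete monoidal `V`-categories whose multiplication is
cocontinuous in each variable. -/
structure VQuantale (X : Type v) extends MonoidalVCat V X where
  separated : IsSeparated toVCat
  cocomplete : IsCocomplete toVCat
  mul_left_cocontinuous : ∀ x, IsCocontinuous toVCat toVCat (fun y => mul x y)
  mul_right_cocontinuous : ∀ x, IsCocontinuous toVCat toVCat (fun y => mul y x)

/-- Promonoidal `V`-categories: monoids in the monoidal category of `V`-distributors. -/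
structure PromonoidalVCat (X : Type v) extends VCat V X where
  P : X → X → X → V
  J : X → V
  P_dist : IsVDistributor (toVCat.tensor toVCat) toVCat (fun p z => P p.1 p.2 z)
  J_dist : IsVDistributor (VCat.point.{u, 0} V) toVCat (fun _ z => J z)
  assoc : ∀ a b c d, (⨆ x, P a b x * P x c d) = ⨆ x, P a x d * P b c x
  unit_left : ∀ x w, (⨆ z, J z * P z x w) = hom x w
  unit_right : ∀ x w, (⨆ z, J z * P x z w) = hom x w

/-- `V`-quantum B-algebras: representable promonoidal `V`-categories. Here `rimp x y` is
`x ▷ y` and `limp x y` is `x ◁ y`. -/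
structure VQuantumBAlg (X : Type v) extends PromonoidalVCat V X where
  rimp : X → X → X
  limp : X → X → X
  unit : X
  P_limp : ∀ x w y, P x w y = hom w (limp x y)
  P_rimp : ∀ x w y, P w x y = hom w (rimp x y)
  J_eq : ∀ x, J x = hom unit x

variable {V}

/-- Morphisms of `V`-quantum B-algebras (`x ≤ y` means `k ≤ hom x y`). -/
structure IsQBMorphism {X : Type v} {Y : Type v'} (A : VQuantumBAlg V X) (B : VQuantumBAlg V Y)
    (f : X → Y) : Prop where
  functor : IsVFunctor A.toVCat B.toVCat f
  rimp_le : ∀ x y, 1 ≤ B.hom (f (A.rimp x y)) (B.rimp (f x) (f y))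
  limp_le : ∀ x y, 1 ≤ B.hom (f (A.limp x y)) (B.limp (f x) (f y))
  unit_le : 1 ≤ B.hom B.unit (f A.unit)

/-- Lax monoidal monads on a `V`-quantale. -/
structure IsLaxMonoidalMonad {X : Type v} (Q : VQuantale V X) (T : X → X) : Prop where
  functor : IsVFunctor Q.toVCat Q.toVCat T
  le : ∀ x, 1 ≤ Q.hom x (T x)
  unit_le : 1 ≤ Q.hom Q.unit (T Q.unit)
  mul_le : ∀ x y, 1 ≤ Q.hom (Q.mul (T x) (T y)) (T (Q.mul x y))
  idem : ∀ x, T (T x) = T x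

/-! ### Monoidal and promonoidal `V`-categories as `(L,V)`-categories -/

/-- `α : L X → X`, `(x₁, …, xₙ) ↦ x₁ * … * xₙ`. -/
def MonoidalVCat.prod {X : Type v} (M : MonoidalVCat V X) (xs : List X) : X :=
  xs.foldr M.mul M.unit

theorem MonoidalVCat.mul_mono {X : Type v} (M : MonoidalVCat V X) (x x' y y' : X) :
    M.hom x x' * M.hom y y' ≤ M.hom (M.mul x y) (M.mul x' y') :=
  M.mul_functor (x, y) (x', y')

theorem MonoidalVCat.prod_append {X : Type v} (M : MonoidalVCat V X) (xs ys : List X) :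
    M.prod (xs ++ ys) = M.mul (M.prod xs) (M.prod ys) := by
  induction xs with
  | nil => simp [prod, M.unit_mul]
  | cons x xs ih =>
    simp only [prod, List.cons_append, List.foldr_cons] at ih ⊢
    rw [ih, M.mul_assoc]

/-- The `(L,V)`-category of a monoidal `V`-category, with structure
`((x₁, …, xₙ), y) ↦ a(x₁ * … * xₙ, y)`. -/
def MonoidalVCat.toLVCat {X : Type v} (M : MonoidalVCat V X) : LVCat V X where
  hom xs y := M.hom (M.prod xs) y
  one_le x := by simpa [prod, M.mul_unit] using M.one_le x
  comp := by
    rw [kleisliComp_le_iff]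
    intro xss ys z
    refine le_trans (mul_le_mul_left ?_ _) (M.comp _ (M.prod ys) z)
    induction xss generalizing ys with
    | nil =>
      cases ys with
      | nil => simpa [listExt] using M.one_le _
      | cons y ys => simp [listExt]
    | cons xs xss ih =>
      cases ys with
      | nil => simp [listExt]
      | cons y ys =>
        rw [List.flatten_cons, M.prod_append]
        exact le_trans (mul_le_mul_right (ih ys) _) (M.mul_mono _ _ _ _)

/-- The `(L,V)`-structure `a₀ = J`, `a₁ = a`, `a₂ = P`, `aₙ = P · (Id ⊠ aₙ₋₁)` of a promonoidal
`V`-category. -/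
def PromonoidalVCat.multiHom {X : Type v} (A : PromonoidalVCat V X) : List X → X → V
  | [], z => A.J z
  | [x], z => A.hom x z
  | [x, y], z => A.P x y z
  | x :: y :: y' :: l, z => ⨆ c, multiHom A (y :: y' :: l) c * A.P x c z

theorem PromonoidalVCat.P_comp {X : Type v} (A : PromonoidalVCat V X) (x y z z' : X) :
    A.P x y z * A.hom z z' ≤ A.P x y z' :=
  le_trans (le_iSup (fun c => A.P x y c * A.hom c z') z) (A.P_dist.2 (x, y) z')

theorem PromonoidalVCat.comp_P {X : Type v} (A : PromonoidalVCat V X) (x y x' y' z : X) :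
    A.hom x x' * A.hom y y' * A.P x' y' z ≤ A.P x y z :=
  le_trans (le_iSup (fun c : X × X => A.hom x c.1 * A.hom y c.2 * A.P c.1 c.2 z) (x', y'))
    (A.P_dist.1 (x, y) z)

theorem PromonoidalVCat.multiHom_cons {X : Type v} (A : PromonoidalVCat V X) (x : X)
    (l : List X) (z : X) :
    A.multiHom (x :: l) z = ⨆ c, A.multiHom l c * A.P x c z := by
  match l with
  | [] => simp [multiHom, A.unit_right]
  | [y] =>
    simp only [multiHom]
    apply le_antisymm
    · refine le_trans ?_ (le_iSup _ y)
      simpa using mul_le_mul_left (A.one_le y) (A.P x y z)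
    · refine iSup_le fun c => ?_
      refine le_trans ?_ (A.comp_P x y x c z)
      rw [mul_assoc]
      simpa using mul_le_mul_left (A.one_le x) (A.hom y c * A.P x c z)
  | y :: y' :: l => simp [multiHom]

theorem PromonoidalVCat.multiHom_comp {X : Type v} (A : PromonoidalVCat V X) (l : List X)
    (z z' : X) : A.multiHom l z * A.hom z z' ≤ A.multiHom l z' := by
  cases l with
  | nil =>
    exact le_trans (le_iSup (fun c => A.J c * A.hom c z') z) (A.J_dist.2 PUnit.unit z')
  | cons x l =>
    simp only [multiHom_cons, iSup_mul', mul_assoc]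
    exact iSup_mono fun c => mul_le_mul_right (A.P_comp _ _ _ _) _

theorem PromonoidalVCat.multiHom_append {X : Type v} (A : PromonoidalVCat V X)
    (xs ws : List X) (y c z : X) :
    A.multiHom xs y * (A.multiHom ws c * A.P y c z) ≤ A.multiHom (xs ++ ws) z := by
  induction xs generalizing y c z with
  | nil =>
    rw [mul_left_comm]
    refine le_trans (mul_le_mul_right ?_ _) (A.multiHom_comp ws c z)
    rw [← A.unit_left c z]
    exact le_iSup (fun y => A.J y * A.P y c z) y
  | cons x xs ih =>
    rw [List.cons_append, multiHom_cons, multiHom_cons, iSup_mul']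
    refine iSup_le fun d => ?_
    have h : A.P x d y * A.P y c z ≤ ⨆ e, A.P x e z * A.P d c e := by
      rw [← A.assoc]
      exact le_iSup (fun y => A.P x d y * A.P y c z) y
    calc A.multiHom xs d * A.P x d y * (A.multiHom ws c * A.P y c z)
        = A.multiHom xs d * A.multiHom ws c * (A.P x d y * A.P y c z) := by
          rw [mul_mul_mul_comm]
      _ ≤ A.multiHom xs d * A.multiHom ws c * ⨆ e, A.P x e z * A.P d c e :=
          mul_le_mul_right h _
      _ ≤ _ := by
          rw [mul_iSup']
          refine iSup_mono fun e => ?_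
          calc A.multiHom xs d * A.multiHom ws c * (A.P x e z * A.P d c e)
              = A.multiHom xs d * (A.multiHom ws c * A.P d c e) * A.P x e z := by
                simp only [mul_assoc, mul_comm (A.P x e z)]
            _ ≤ _ := mul_le_mul_left (ih d c e) _

/-- The `(L,V)`-category of a promonoidal `V`-category. -/
def PromonoidalVCat.toLVCat {X : Type v} (A : PromonoidalVCat V X) : LVCat V X where
  hom := A.multiHom
  one_le := A.one_le
  comp := by
    rw [kleisliComp_le_iff]
    intro xss ys z
    induction xss generalizing ys z with
    | nil =>
      cases ys with
      | nil => simp [listExt]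
      | cons y ys => simp [listExt, Quantale.bot_mul]
    | cons xs xss ih =>
      cases ys with
      | nil => simp [listExt, Quantale.bot_mul]
      | cons y ys =>
        rw [listExt, multiHom_cons, mul_iSup', List.flatten_cons]
        refine iSup_le fun c => ?_
        calc A.multiHom xs y * listExt A.multiHom xss ys * (A.multiHom ys c * A.P y c z)
            = A.multiHom xs y * (listExt A.multiHom xss ys * A.multiHom ys c * A.P y c z) := by
              simp only [mul_assoc]
          _ ≤ A.multiHom xs y * (A.multiHom xss.flatten c * A.P y c z) :=
              mul_le_mul_right (mul_le_mul_left (ih ys c) _) _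
          _ ≤ _ := A.multiHom_append xs _ y c z

end Monoidal

set_option linter.unusedSectionVars false

section Residuals

variable {V : Type u} [CommMonoid V] [CompleteLattice V] [IsQuantale V]

theorem VCat.eq_of_hom {X : Type v} {A : VCat V X} (hA : IsSeparated A) {x y : X}
    (h : ∀ z, A.hom x z = A.hom y z) : x = y :=
  hA x y (by rw [h]; exact A.one_le y) (by rw [← h]; exact A.one_le x)

/-- A cocontinuous endomap of a cocomplete `V`-category has a right adjoint. -/
theorem exists_right_adjoint {X : Type v} {A : VCat V X} (hA : IsCocomplete A) {h : X → X}
    (hh : IsCocontinuous A A h) (z : X) : ∃ r, ∀ x, A.hom x r = A.hom (h x) z := by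
  have hj : IsVDistributor A (VCat.point.{u, v} V) (fun x _ => A.hom (h x) z) := by
    constructor
    · intro x _
      refine iSup_le fun y => ?_
      exact le_trans (mul_le_mul_left (hh.1 x y) _) (A.comp _ _ _)
    · intro x _
      refine iSup_le fun y => ?_
      simp [VCat.point]
  have hid : IsVFunctor A A (fun x => x) := fun x y => le_rfl
  obtain ⟨g, hg⟩ := hA X PUnit A (VCat.point V) _ (fun x => x) hj hid
  have hg' := hh.2 X PUnit A (VCat.point V) _ (fun x => x) g hj hid hg
  refine ⟨g PUnit.unit, fun x => le_antisymm ?_ ?_⟩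
  · have h1 : 1 ≤ A.hom (h (g PUnit.unit)) z := by
      rw [hg'.2 PUnit.unit z]
      refine le_iInf fun x => ?_
      rw [le_ihom, mul_one]
    calc A.hom x (g PUnit.unit) ≤ A.hom (h x) (h (g PUnit.unit)) := hh.1 _ _
      _ ≤ A.hom (h x) (h (g PUnit.unit)) * A.hom (h (g PUnit.unit)) z := by
          simpa using mul_le_mul_right h1 (A.hom (h x) (h (g PUnit.unit)))
      _ ≤ _ := A.comp _ _ _
  · have h2 := A.one_le (g PUnit.unit)
    rw [hg.2 PUnit.unit (g PUnit.unit), le_iInf_iff] at h2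
    simpa [le_ihom] using h2 x

/-- Left adjoints are cocontinuous. -/
theorem isCocontinuous_of_adjoint {X : Type v} {A : VCat V X} {h r : X → X}
    (adj : ∀ x z, A.hom (h x) z = A.hom x (r z)) (hh : IsVFunctor A A h) :
    IsCocontinuous A A h := by
  refine ⟨hh, fun Y Z _ C j f g _ _ hg => ⟨fun z z' => ?_, fun z y => ?_⟩⟩
  · exact le_trans (hg.1 z z') (hh _ _)
  · simp only [adj]
    exact hg.2 z (r y)

theorem MonoidalVCat.mul_left_functor {X : Type v} (M : MonoidalVCat V X) (x : X) :
    IsVFunctor M.toVCat M.toVCat (fun y => M.mul x y) := fun y y' => by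
  refine le_trans ?_ (M.mul_mono x x y y')
  simpa using mul_le_mul_left (M.one_le x) (M.hom y y')

theorem MonoidalVCat.mul_right_functor {X : Type v} (M : MonoidalVCat V X) (x : X) :
    IsVFunctor M.toVCat M.toVCat (fun y => M.mul y x) := fun y y' => by
  refine le_trans ?_ (M.mul_mono y y' x x)
  simpa using mul_le_mul_right (M.one_le x) (M.hom y y')

/-- The residual `y ▷ z` of a `V`-quantale, right adjoint to `- * y`. -/
noncomputable def VQuantale.rimp {X : Type v} (Q : VQuantale V X) (y z : X) : X :=
  (exists_right_adjoint Q.cocomplete (Q.mul_right_cocontinuous y) z).choose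

/-- The residual `x ◁ z` of a `V`-quantale, right adjoint to `x * -`. -/
noncomputable def VQuantale.limp {X : Type v} (Q : VQuantale V X) (x z : X) : X :=
  (exists_right_adjoint Q.cocomplete (Q.mul_left_cocontinuous x) z).choose

theorem VQuantale.hom_rimp {X : Type v} (Q : VQuantale V X) (x y z : X) :
    Q.hom x (Q.rimp y z) = Q.hom (Q.mul x y) z :=
  (exists_right_adjoint Q.cocomplete (Q.mul_right_cocontinuous y) z).choose_spec x

theorem VQuantale.hom_limp {X : Type v} (Q : VQuantale V X) (x y z : X) :
    Q.hom y (Q.limp x z) = Q.hom (Q.mul x y) z :=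
  (exists_right_adjoint Q.cocomplete (Q.mul_left_cocontinuous x) z).choose_spec y

theorem VCat.iSup_hom_mul {X : Type v} (A : VCat V X) (F : X → V) (x : X)
    (hF : ∀ y, A.hom x y * F y ≤ F x) : (⨆ y, A.hom x y * F y) = F x := by
  refine le_antisymm (iSup_le hF) (le_trans ?_ (le_iSup _ x))
  simpa using mul_le_mul_left (A.one_le x) (F x)

/-- A monoidal `V`-category as a promonoidal one: `P(x,y,z) = a(x * y, z)`, `J(z) = a(u, z)`. -/
def MonoidalVCat.toPromonoidal {X : Type v} (M : MonoidalVCat V X) : PromonoidalVCat V X where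
  toVCat := M.toVCat
  P x y z := M.hom (M.mul x y) z
  J z := M.hom M.unit z
  P_dist := by
    refine ⟨fun p z => iSup_le fun q => ?_, fun p z => iSup_le fun q => M.comp _ _ _⟩
    exact le_trans (mul_le_mul_left (M.mul_functor p q) _) (M.comp _ _ _)
  J_dist := by
    refine ⟨fun p z => iSup_le fun q => ?_, fun p z => iSup_le fun q => M.comp _ _ _⟩
    simp [VCat.point]
  assoc a b c d := by
    rw [M.toVCat.iSup_hom_mul (fun x => M.hom (M.mul x c) d)]
    · simp only [mul_comm (M.hom (M.mul a _) d)]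
      rw [M.toVCat.iSup_hom_mul (fun x => M.hom (M.mul a x) d), M.mul_assoc]
      intro y
      exact le_trans (mul_le_mul_left (M.mul_left_functor a _ _) _) (M.comp _ _ _)
    · intro y
      exact le_trans (mul_le_mul_left (M.mul_right_functor c _ _) _) (M.comp _ _ _)
  unit_left x w := by
    rw [M.toVCat.iSup_hom_mul (fun z => M.hom (M.mul z x) w), M.unit_mul]
    intro y
    exact le_trans (mul_le_mul_left (M.mul_right_functor x _ _) _) (M.comp _ _ _)
  unit_right x w := by
    rw [M.toVCat.iSup_hom_mul (fun z => M.hom (M.mul x z) w), M.mul_unit]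
    intro y
    exact le_trans (mul_le_mul_left (M.mul_left_functor x _ _) _) (M.comp _ _ _)

/-- A `V`-quantale as a `V`-quantum B-algebra, through its residuals. -/
noncomputable def VQuantale.toQB {X : Type v} (Q : VQuantale V X) : VQuantumBAlg V X where
  toPromonoidalVCat := Q.toMonoidalVCat.toPromonoidal
  rimp := Q.rimp
  limp := Q.limp
  unit := Q.unit
  P_limp x w y := (Q.hom_limp x w y).symm
  P_rimp x w y := (Q.hom_rimp w x y).symm
  J_eq _ := rfl

end Residuals

section FixedPoints

variable {V : Type u} [CommMonoid V] [CompleteLattice V] [IsQuantale V]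
variable {X : Type v} {Q : VQuantale V X} {T : X → X}

theorem VCat.hom_le_of_le_right {A : VCat V X} {x y z : X} (h : 1 ≤ A.hom y z) :
    A.hom x y ≤ A.hom x z := by
  refine le_trans ?_ (A.comp x y z)
  simpa using mul_le_mul_right h (A.hom x y)

theorem VCat.hom_le_of_le_left {A : VCat V X} {x y z : X} (h : 1 ≤ A.hom x y) :
    A.hom y z ≤ A.hom x z := by
  refine le_trans ?_ (A.comp x y z)
  simpa using mul_le_mul_left h (A.hom y z)

theorem IsLaxMonoidalMonad.hom_left (hT : IsLaxMonoidalMonad Q T) (x : X) {y : X}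
    (hy : T y = y) : Q.hom (T x) y = Q.hom x y := by
  refine le_antisymm (VCat.hom_le_of_le_left (hT.le x)) ?_
  simpa [hy] using hT.functor x y

theorem IsLaxMonoidalMonad.ext (_hT : IsLaxMonoidalMonad Q T) {x y : X}
    (hx : T x = x) (hy : T y = y) (h : ∀ z, T z = z → Q.hom x z = Q.hom y z) : x = y :=
  Q.separated x y (by rw [h y hy]; exact Q.one_le y) (by rw [← h x hx]; exact Q.one_le x)

theorem IsLaxMonoidalMonad.limp_fixed (hT : IsLaxMonoidalMonad Q T) (x : X) {z : X}
    (hz : T z = z) : T (Q.limp x z) = Q.limp x z := by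
  refine Q.separated _ _ ?_ (hT.le _)
  rw [Q.hom_limp]
  have h1 : 1 ≤ Q.hom (Q.mul x (Q.limp x z)) z := by
    rw [← Q.hom_limp]; exact Q.one_le _
  have h2 : 1 ≤ Q.hom (Q.mul x (T (Q.limp x z))) (Q.mul (T x) (T (Q.limp x z))) :=
    le_trans (hT.le x) (Q.mul_right_functor _ _ _)
  refine le_trans (le_trans h2 (VCat.hom_le_of_le_right (hT.mul_le _ _))) ?_
  refine VCat.hom_le_of_le_right ?_
  rwa [hT.hom_left _ hz]

theorem IsLaxMonoidalMonad.rimp_fixed (hT : IsLaxMonoidalMonad Q T) (x : X) {z : X}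
    (hz : T z = z) : T (Q.rimp x z) = Q.rimp x z := by
  refine Q.separated _ _ ?_ (hT.le _)
  rw [Q.hom_rimp]
  have h1 : 1 ≤ Q.hom (Q.mul (Q.rimp x z) x) z := by
    rw [← Q.hom_rimp]; exact Q.one_le _
  have h2 : 1 ≤ Q.hom (Q.mul (T (Q.rimp x z)) x) (Q.mul (T (Q.rimp x z)) (T x)) :=
    le_trans (hT.le x) (Q.mul_left_functor _ _ _)
  refine le_trans (le_trans h2 (VCat.hom_le_of_le_right (hT.mul_le _ _))) ?_
  refine VCat.hom_le_of_le_right ?_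
  rwa [hT.hom_left _ hz]

theorem IsLaxMonoidalMonad.hom_mul_left (hT : IsLaxMonoidalMonad Q T) (x y : X) {z : X}
    (hz : T z = z) : Q.hom (Q.mul (T x) y) z = Q.hom (Q.mul x y) z := by
  rw [← Q.hom_rimp, ← Q.hom_rimp, hT.hom_left _ (hT.rimp_fixed y hz)]

theorem IsLaxMonoidalMonad.hom_mul_right (hT : IsLaxMonoidalMonad Q T) (x y : X) {z : X}
    (hz : T z = z) : Q.hom (Q.mul x (T y)) z = Q.hom (Q.mul x y) z := by
  rw [← Q.hom_limp, ← Q.hom_limp, hT.hom_left _ (hT.limp_fixed x hz)]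

/-- The `V`-quantale `Q^T` of fixed points of a lax monoidal monad `T` on `Q`: the
`V`-structure is induced by `Q`, the multiplication is `T (x * y)` and the unit is `T k`. -/
def VQuantale.fixedPoints (Q : VQuantale V X) (T : X → X) (hT : IsLaxMonoidalMonad Q T) :
    VQuantale V {x : X // T x = x} where
  hom x y := Q.hom x.1 y.1
  one_le x := Q.one_le x.1
  comp x y z := Q.comp _ _ _
  mul x y := ⟨T (Q.mul x.1 y.1), hT.idem _⟩
  unit := ⟨T Q.unit, hT.idem _⟩
  mul_functor p q := le_trans (Q.mul_mono _ _ _ _) (hT.functor _ _)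
  mul_assoc x y z := Subtype.ext <| hT.ext (hT.idem _) (hT.idem _) fun w hw => by
    simp only [hT.hom_left _ hw, hT.hom_mul_left _ _ hw, hT.hom_mul_right _ _ hw, Q.mul_assoc]
  unit_mul x := Subtype.ext <| hT.ext (hT.idem _) x.2 fun w hw => by
    simp only [hT.hom_left _ hw, hT.hom_mul_left _ _ hw, Q.unit_mul]
  mul_unit x := Subtype.ext <| hT.ext (hT.idem _) x.2 fun w hw => by
    simp only [hT.hom_left _ hw, hT.hom_mul_right _ _ hw, Q.mul_unit]
  separated x y h h' := Subtype.ext (Q.separated _ _ h h')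
  cocomplete Y Z A C j f hj hf := by
    obtain ⟨g, hg, hg'⟩ := Q.cocomplete Y Z A C j (fun y => (f y).1) hj hf
    refine ⟨fun z => ⟨T (g z), hT.idem _⟩, fun z z' => ?_, fun z y => ?_⟩
    · exact le_trans (hg z z') (hT.functor _ _)
    · exact (hT.hom_left _ y.2).trans (hg' z y.1)
  mul_left_cocontinuous x :=
    isCocontinuous_of_adjoint
      (r := fun z => ⟨Q.limp x.1 z.1, hT.limp_fixed _ z.2⟩)
      (fun y z => (hT.hom_left _ z.2).trans (Q.hom_limp _ _ _).symm)
      (fun y y' => le_trans (Q.mul_left_functor x.1 _ _) (hT.functor _ _))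
  mul_right_cocontinuous x :=
    isCocontinuous_of_adjoint
      (r := fun z => ⟨Q.rimp x.1 z.1, hT.rimp_fixed _ z.2⟩)
      (fun y z => (hT.hom_left _ z.2).trans (Q.hom_rimp _ _ _).symm)
      (fun y y' => le_trans (Q.mul_right_functor x.1 _ _) (hT.functor _ _))

end FixedPoints

section Presheaves

variable {V : Type u} [CommMonoid V] [CompleteLattice V] [IsQuantale V]
variable {X : Type v}

/-- The `(L,V)`-presheaves on an `(L,V)`-category `(X, a)`: the `φ : L X → V` with `φ ∘ a ≤ φ`,
that is, the `(L,V)`-distributors from `X` to the one-point `(L,V)`-category. By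
`isPresheaf_iff` below these are the `(L,V)`-functors `X^op ⊠ E → V`. -/
def IsPresheaf (A : LVCat V X) (φ : List X → V) : Prop :=
  ∀ xs, kleisliComp A.hom (fun ys (_ : Unit) => φ ys) xs () ≤ φ xs

/-- The underlying set of `D_L(X)`. -/
abbrev Presheaf (A : LVCat V X) : Type (max u v) := {φ : List X → V // IsPresheaf A φ}

theorem isPresheaf_iff' {A : LVCat V X} {φ : List X → V} :
    IsPresheaf A φ ↔ ∀ xss ys, listExt A.hom xss ys * φ ys ≤ φ xss.flatten := by
  have h := kleisliComp_le_iff (r := A.hom) (s := fun ys (_ : Unit) => φ ys)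
    (t := fun ys (_ : Unit) => φ ys)
  constructor
  · intro hφ xss ys
    exact h.1 (fun xs _ => hφ xs) xss ys ()
  · intro hφ xs
    exact h.2 (fun xss ys _ => hφ xss ys) xs ()

/-- The structure of `X^op ⊠ E` at `(γ, (ys, •))` is
`(L a · m°)(ys, m(L π₁ γ)) ⊗ e°(L π₂ γ, •)`, and that of `V` is `[v₁ ⊗ … ⊗ vₙ, w]`. -/
theorem isPresheaf_iff (A : LVCat V X) (φ : List X → V) :
    IsPresheaf A φ ↔ ∀ (γ : List (List X × Unit)) (y : List X × Unit),
      listHat A.hom y.1 (γ.map Prod.fst).flatten *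
          (LVCat.point V).hom (γ.map Prod.snd) y.2 ≤
        ihom ((γ.map fun c => φ c.1).prod) (φ y.1) := by
  rw [isPresheaf_iff']
  constructor
  · rintro h γ ⟨ys, _⟩
    match γ with
    | [] => simp [LVCat.point, Quantale.mul_bot]
    | _ :: _ :: _ => simp [LVCat.point, Quantale.mul_bot]
    | [c] =>
      rw [le_ihom]
      simp only [List.map_cons, List.map_nil, List.flatten_cons, List.flatten_nil,
        List.append_nil, LVCat.point, mul_one, List.prod_cons, List.prod_nil, listHat,
        mul_iSup', iSup_le_iff]
      rintro xss rfl
      rw [mul_comm]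
      exact h xss c.1
  · intro h xss ys
    have h1 := h [(ys, ())] (xss.flatten, ())
    rw [le_ihom] at h1
    simp only [List.map_cons, List.map_nil, List.flatten_cons, List.flatten_nil,
      List.append_nil, LVCat.point, mul_one, List.prod_cons, List.prod_nil] at h1
    refine le_trans ?_ h1
    rw [mul_comm]
    refine mul_le_mul_right ?_ _
    exact le_iSup₂_of_le (f := fun (xs : List (List X)) (_ : xs.flatten = xss.flatten) =>
      listExt A.hom xs ys) xss rfl le_rfl

/-- The Yoneda embedding `x ↦ a(-, x)`. -/
def yoneda (A : LVCat V X) (x : X) : Presheaf A :=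
  ⟨fun xs => A.hom xs x, isPresheaf_iff'.2 fun xss ys => A.comp' xss ys x⟩

/-- The `V`-category of `(L,V)`-presheaves. -/
def presheafVCat (A : LVCat V X) : VCat V (Presheaf A) where
  hom φ ψ := ⨅ xs, ihom (φ.1 xs) (ψ.1 xs)
  one_le φ := le_iInf fun xs => by rw [le_ihom, mul_one]
  comp φ ψ χ := le_iInf fun xs => by
    rw [le_ihom, ← mul_assoc]
    refine le_trans (mul_le_mul' ?_ (iInf_le _ xs)) (le_ihom.1 le_rfl)
    exact le_trans (mul_le_mul_right (iInf_le _ xs) _) (le_ihom.1 le_rfl)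

theorem le_presheaf_hom {A : LVCat V X} {φ ψ : Presheaf A} {c : V} :
    c ≤ (presheafVCat A).hom φ ψ ↔ ∀ xs, φ.1 xs * c ≤ ψ.1 xs := by
  simp only [presheafVCat, le_iInf_iff, le_ihom]

/-- The convolution of two presheaves:
`(φ * ψ)(xs) = ⋁ φ(ys) ⊗ ψ(zs)` over all `ys`, `zs` with `ys ++ zs = xs`. -/
def conv {A : LVCat V X} (φ ψ : Presheaf A) : Presheaf A :=
  ⟨fun xs => ⨆ (ys : List X) (zs : List X) (_ : ys ++ zs = xs), φ.1 ys * ψ.1 zs, by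
    rw [isPresheaf_iff']
    intro xss ws
    simp only [mul_iSup', iSup_le_iff]
    rintro ys zs rfl
    rw [listExt_append_right, mul_mul_mul_comm]
    refine le_trans (mul_le_mul' (isPresheaf_iff'.1 φ.2 _ _) (isPresheaf_iff'.1 ψ.2 _ _)) ?_
    exact le_iSup₂_of_le _ _ (le_iSup_of_le
      (by rw [← List.flatten_append, List.take_append_drop]) le_rfl)⟩

/-- The unit presheaf: `k` at the empty list and `⊥` elsewhere. -/
def unitPresheaf (A : LVCat V X) : Presheaf A :=
  ⟨fun xs => ⨆ _ : xs = [], 1, by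
    rw [isPresheaf_iff']
    intro xss ys
    rw [mul_iSup', iSup_le_iff]
    rintro rfl
    cases xss <;> simp [listExt]⟩

theorem le_conv {A : LVCat V X} (φ ψ : Presheaf A) (ys zs : List X) :
    φ.1 ys * ψ.1 zs ≤ (conv φ ψ).1 (ys ++ zs) :=
  le_iSup₂_of_le ys zs (le_iSup_of_le rfl le_rfl)

theorem conv_mul_le {A : LVCat V X} {φ ψ χ : Presheaf A} {c : V} :
    (∀ xs, (conv φ ψ).1 xs * c ≤ χ.1 xs) ↔
      ∀ ys zs, φ.1 ys * ψ.1 zs * c ≤ χ.1 (ys ++ zs) := by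
  simp only [conv, iSup_mul', iSup_le_iff]
  exact ⟨fun h ys zs => h _ ys zs rfl, by rintro h _ ys zs rfl; exact h ys zs⟩

/-- The right adjoint of `φ * -` at `ψ`. -/
def convLimp {A : LVCat V X} (φ ψ : Presheaf A) : Presheaf A :=
  ⟨fun zs => ⨅ ys, ihom (φ.1 ys) (ψ.1 (ys ++ zs)), by
    rw [isPresheaf_iff']
    intro xss zs
    refine le_iInf fun ys => ?_
    rw [le_ihom, mul_left_comm]
    have h0 : φ.1 ys * (⨅ ys, ihom (φ.1 ys) (ψ.1 (ys ++ zs))) ≤ ψ.1 (ys ++ zs) :=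
      le_ihom.1 (iInf_le _ ys)
    refine le_trans (mul_le_mul_right h0 _) ?_
    have h := isPresheaf_iff'.1 ψ.2 ((ys.map fun x => [x]) ++ xss) (ys ++ zs)
    have h1 : ((ys.map fun x => [x]) ++ xss).flatten = ys ++ xss.flatten := by
      rw [List.flatten_append, flatten_map_singleton]
    rw [h1] at h
    refine le_trans (mul_le_mul_left ?_ _) h
    refine le_trans ?_ (listExt_append _ _ _ _ _)
    simpa using mul_le_mul_left (A.one_le_listExt ys) (listExt A.hom xss zs)⟩

/-- The right adjoint of `- * φ` at `ψ`. -/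
def convRimp {A : LVCat V X} (φ ψ : Presheaf A) : Presheaf A :=
  ⟨fun ys => ⨅ zs, ihom (φ.1 zs) (ψ.1 (ys ++ zs)), by
    rw [isPresheaf_iff']
    intro xss ys
    refine le_iInf fun zs => ?_
    rw [le_ihom, mul_left_comm]
    have h0 : φ.1 zs * (⨅ zs, ihom (φ.1 zs) (ψ.1 (ys ++ zs))) ≤ ψ.1 (ys ++ zs) :=
      le_ihom.1 (iInf_le _ zs)
    refine le_trans (mul_le_mul_right h0 _) ?_
    have h := isPresheaf_iff'.1 ψ.2 (xss ++ (zs.map fun x => [x])) (ys ++ zs)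
    have h1 : (xss ++ (zs.map fun x => [x])).flatten = xss.flatten ++ zs := by
      rw [List.flatten_append, flatten_map_singleton]
    rw [h1] at h
    refine le_trans (mul_le_mul_left ?_ _) h
    refine le_trans ?_ (listExt_append _ _ _ _ _)
    simpa using mul_le_mul_right (A.one_le_listExt zs) (listExt A.hom xss ys)⟩

theorem hom_convLimp {A : LVCat V X} (φ ψ χ : Presheaf A) :
    (presheafVCat A).hom (conv φ χ) ψ = (presheafVCat A).hom χ (convLimp φ ψ) := by
  refine eq_of_forall_le_iff fun c => ?_
  rw [le_presheaf_hom, le_presheaf_hom, conv_mul_le]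
  simp only [convLimp, le_iInf_iff, le_ihom, mul_assoc]
  exact forall_comm

theorem hom_convRimp {A : LVCat V X} (φ ψ χ : Presheaf A) :
    (presheafVCat A).hom (conv χ φ) ψ = (presheafVCat A).hom χ (convRimp φ ψ) := by
  refine eq_of_forall_le_iff fun c => ?_
  rw [le_presheaf_hom, le_presheaf_hom, conv_mul_le]
  simp only [convRimp, le_iInf_iff, le_ihom]
  refine forall_congr' fun ys => forall_congr' fun zs => ?_
  rw [mul_comm (χ.1 ys), mul_assoc]

theorem presheaf_separated (A : LVCat V X) : IsSeparated (presheafVCat A) := by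
  intro φ ψ h h'
  rw [le_presheaf_hom] at h h'
  exact Subtype.ext (funext fun xs => le_antisymm (by simpa using h xs) (by simpa using h' xs))

theorem presheaf_cocomplete (A : LVCat V X) : IsCocomplete (presheafVCat A) := by
  intro Y Z B C j f hj hf
  refine ⟨fun z => ⟨fun xs => ⨆ y, j y z * (f y).1 xs, ?_⟩, fun z z' => ?_, fun z ψ => ?_⟩
  · rw [isPresheaf_iff']
    intro xss xs
    rw [mul_iSup']
    refine iSup_mono fun y => ?_
    rw [mul_left_comm]
    exact mul_le_mul_right (isPresheaf_iff'.1 (f y).2 _ _) _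
  · rw [le_presheaf_hom]
    intro xs
    simp only [iSup_mul']
    refine iSup_mono fun y => ?_
    rw [mul_right_comm]
    refine mul_le_mul_left (le_trans ?_ (hj.2 y z')) _
    exact le_iSup (fun c => j y c * C.hom c z') z
  · refine eq_of_forall_le_iff fun c => ?_
    simp only [le_presheaf_hom, le_iInf_iff, le_ihom, iSup_mul', iSup_le_iff]
    rw [forall_comm]
    refine forall_congr' fun y => forall_congr' fun xs => ?_
    rw [mul_comm (j y z), mul_assoc]

theorem conv_functor {A : LVCat V X} :
    IsVFunctor ((presheafVCat A).tensor (presheafVCat A)) (presheafVCat A)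
      (fun p => conv p.1 p.2) := by
  rintro ⟨φ, ψ⟩ ⟨φ', ψ'⟩
  rw [le_presheaf_hom, conv_mul_le]
  intro ys zs
  refine le_trans ?_ (le_conv _ _ _ _)
  simp only [VCat.tensor]
  rw [mul_mul_mul_comm]
  exact mul_le_mul' (le_presheaf_hom.1 le_rfl ys) (le_presheaf_hom.1 le_rfl zs)

theorem conv_assoc {A : LVCat V X} (φ ψ χ : Presheaf A) :
    conv (conv φ ψ) χ = conv φ (conv ψ χ) := by
  refine VCat.eq_of_hom (presheaf_separated A) fun θ => ?_
  have h : convLimp φ (convRimp χ θ) = convRimp χ (convLimp φ θ) := by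
    refine Subtype.ext (funext fun xs => eq_of_forall_le_iff fun c => ?_)
    simp only [convLimp, convRimp, le_iInf_iff, le_ihom, List.append_assoc]
    rw [forall_comm]
    refine forall_congr' fun zs => forall_congr' fun ys => ?_
    rw [mul_left_comm]
  rw [hom_convRimp, hom_convLimp, hom_convLimp, hom_convRimp, h]

theorem unit_conv {A : LVCat V X} (φ : Presheaf A) : conv (unitPresheaf A) φ = φ := by
  refine VCat.eq_of_hom (presheaf_separated A) fun θ => ?_
  refine eq_of_forall_le_iff fun c => ?_
  rw [le_presheaf_hom, le_presheaf_hom, conv_mul_le]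
  simp only [unitPresheaf, iSup_mul', iSup_le_iff, one_mul]
  exact ⟨fun h xs => h [] xs rfl, by rintro h _ zs rfl; exact h zs⟩

theorem conv_unit {A : LVCat V X} (φ : Presheaf A) : conv φ (unitPresheaf A) = φ := by
  refine VCat.eq_of_hom (presheaf_separated A) fun θ => ?_
  refine eq_of_forall_le_iff fun c => ?_
  rw [le_presheaf_hom, le_presheaf_hom, conv_mul_le]
  simp [unitPresheaf, iSup_mul', mul_iSup']

/-- The `V`-quantale `D_L(X)` of `(L,V)`-presheaves on `X`. -/
def presheafQuantale (A : LVCat V X) : VQuantale V (Presheaf A) where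
  toVCat := presheafVCat A
  mul := conv
  unit := unitPresheaf A
  mul_functor := conv_functor
  mul_assoc := conv_assoc
  unit_mul := unit_conv
  mul_unit := conv_unit
  separated := presheaf_separated A
  cocomplete := presheaf_cocomplete A
  mul_left_cocontinuous φ :=
    isCocontinuous_of_adjoint (r := convLimp φ) (fun χ ψ => hom_convLimp φ ψ χ)
      (fun χ χ' => le_presheaf_hom.2 <| conv_mul_le.2 fun ys zs => by
        rw [mul_assoc]
        exact le_trans (mul_le_mul_right (le_presheaf_hom.1 le_rfl zs) _) (le_conv _ _ _ _))
  mul_right_cocontinuous φ :=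
    isCocontinuous_of_adjoint (r := convRimp φ) (fun χ ψ => hom_convRimp φ ψ χ)
      (fun χ χ' => le_presheaf_hom.2 <| conv_mul_le.2 fun ys zs => by
        rw [mul_right_comm]
        exact le_trans (mul_le_mul_left (le_presheaf_hom.1 le_rfl ys) _) (le_conv _ _ _ _))

/-- The `(L,V)`-structure of `D_L(X)` is
`[(φ₁, …, φₙ), ψ] = ⋀ [φ₁(xs₁) ⊗ … ⊗ φₙ(xsₙ), ψ(xs₁ ++ … ++ xsₙ)]`. -/
theorem presheafQuantale_multiHom (A : LVCat V X) (φs : List (Presheaf A)) (ψ : Presheaf A) :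
    (presheafQuantale A).toLVCat.hom φs ψ =
      ⨅ xss : {xss : List (List X) // xss.length = φs.length},
        ihom ((List.zipWith (fun φ xs => φ.1 xs) φs xss.1).prod) (ψ.1 xss.1.flatten) := by
  refine eq_of_forall_le_iff fun c => ?_
  simp only [le_iInf_iff, Subtype.forall, le_ihom]
  induction φs generalizing c ψ with
  | nil =>
    refine le_presheaf_hom.trans ?_
    simp [MonoidalVCat.prod, presheafQuantale, unitPresheaf, iSup_mul']
  | cons φ φs ih =>
    have h1 : c ≤ (presheafQuantale A).toLVCat.hom (φ :: φs) ψ ↔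
        c ≤ (presheafQuantale A).toLVCat.hom φs (convLimp φ ψ) := by
      refine iff_of_eq (congrArg (c ≤ ·) ?_)
      exact hom_convLimp φ ψ _
    rw [h1, ih]
    simp only [convLimp, le_iInf_iff, le_ihom]
    constructor
    · intro h xss hx
      match xss, hx with
      | xs :: xss, hx =>
        have := h xss (by simpa using hx) xs
        simpa [mul_assoc] using this
    · intro h xss hx xs
      have := h (xs :: xss) (by simpa using hx)
      simpa [mul_assoc] using this

end Presheaves

section Hulls

variable {V : Type u} [CommMonoid V] [CompleteLattice V] [IsQuantale V]

/-- Dense maps from an `(L,V)`-category to a `V`-quantale: fully faithful `(L,V)`-functors `i`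
such that each `q` is both the (`V`-enriched) limit of `i` weighted by `i^* · q_*` and the
`(L,V)`-colimit of `i` weighted by the Kleisli composite of `i_⊛` and `q^⊛`. -/
structure IsDense {X : Type v} {Y : Type v'} (A : LVCat V X) (Q : VQuantale V Y)
    (i : X → Y) : Prop where
  fullyFaithful : IsFullyFaithful A Q.toLVCat i
  lim : ∀ q : Y, IsLimit (VCat.point.{u, 0} V) Q.toVCat
    (relComp (lowerStar Q.toVCat fun _ => q) (upperStar Q.toVCat i)) i (fun _ => q)
  colim : ∀ q : Y, IsLColimit (LVCat.point.{u, 0} V) Q.toLVCat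
    (kleisliComp (lowerLStar Q.toLVCat i) (upperLStar Q.toLVCat fun _ => q)) i (fun _ => q)

/-- Injective objects in the category of `(L,V)`-categories, with respect to fully faithful
`(L,V)`-functors. -/
def IsInjective {E : Type v} (D : LVCat V E) : Prop :=
  ∀ (Y : Type w₁) (Z : Type w₂) (B : LVCat V Y) (C : LVCat V Z) (f : Y → Z) (g : Y → E),
    IsFullyFaithful B C f → IsLVFunctor B D g →
      ∃ h : Z → E, IsLVFunctor C D h ∧ ∀ y, h (f y) = g y

/-- Essential maps in the category of `(L,V)`-categories. -/
def IsEssential {X : Type v} {E : Type v'} (A : LVCat V X) (D : LVCat V E) (e : X → E) : Prop :=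
  ∀ (Z : Type w) (C : LVCat V Z) (f : E → Z), IsLVFunctor D C f →
    IsFullyFaithful A C (fun x => f (e x)) → IsFullyFaithful D C f

/-- `e : X → E` exhibits `E` as an injective hull of `X` in the category of
`(L,V)`-categories. -/
def IsInjectiveHull {X : Type v} {E : Type v'} (A : LVCat V X) (D : LVCat V E)
    (e : X → E) : Prop :=
  IsFullyFaithful A D e ∧ IsInjective.{u, v', w₁, w₂} D ∧ IsEssential.{u, v, v', w₃} A D e

/-- Injective objects in the category of `V`-quantum B-algebras, with respect to the morphisms
that are fully faithful as `(L,V)`-functors. -/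
def IsQBInjective {E : Type v} (D : VQuantumBAlg V E) : Prop :=
  ∀ (Y : Type w₁) (Z : Type w₂) (B : VQuantumBAlg V Y) (C : VQuantumBAlg V Z)
    (f : Y → Z) (g : Y → E),
    IsQBMorphism B C f → IsFullyFaithful B.toLVCat C.toLVCat f → IsQBMorphism B D g →
      ∃ h : Z → E, IsQBMorphism C D h ∧ ∀ y, h (f y) = g y

/-- Essential morphisms in the category of `V`-quantum B-algebras. -/
def IsQBEssential {X : Type v} {E : Type v'} (A : VQuantumBAlg V X) (D : VQuantumBAlg V E)
    (e : X → E) : Prop :=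
  ∀ (Z : Type w) (C : VQuantumBAlg V Z) (f : E → Z), IsQBMorphism D C f →
    IsFullyFaithful A.toLVCat C.toLVCat (fun x => f (e x)) →
      IsFullyFaithful D.toLVCat C.toLVCat f

/-- `e : X → E` exhibits `E` as an injective hull of `X` in the category of
`V`-quantum B-algebras. -/
def IsQBInjectiveHull {X : Type v} {E : Type v'} (A : VQuantumBAlg V X) (D : VQuantumBAlg V E)
    (e : X → E) : Prop :=
  IsQBMorphism A D e ∧ IsFullyFaithful A.toLVCat D.toLVCat e ∧
    IsQBInjective.{u, v', w₁, w₂} D ∧ IsQBEssential.{u, v, v', w₃} A D e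

end Hulls

end QEnr

/-!
The closure `T = repClosure` sends a presheaf `φ` to the limit of representables
`⋀ₓ [D(φ, y x), y x]`. It is an idempotent monad on `D_L(X)` for every `(L,V)`-category `X`, and
its fixed points are the weighted limits of representables.

Representability of the promonoidal structure enters through one fact: in a `V`-quantum B-algebra
`a(ys ++ zs, x)` is representable in `ys` for fixed `zs`, and in `zs` for fixed `ys`, by iterated
residuals of `x` (`VQuantumBAlg.toLVCat_cons`, `VQuantumBAlg.toLVCat_concat`). So the residuals of
a representable by any presheaf are limits of representables, hence fixed by `T`, which makes `T`
lax monoidal (`repClosure_isLaxMonoidalMonad`).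

In the `V`-quantale `hull B` of fixed points, residuals of representables are computed in `X`, so
the Yoneda embedding `i` is fully faithful (`hullEmb_isFullyFaithful`), and every `q` satisfies
`q(xs) = Q(i x₁ * ⋯ * i xₙ, q)` (`hull_hom_prod_hullEmb`). Thus `q` is both a `V`-limit of
representables and a `V`-colimit of their products. As the multiplication of a `V`-quantale is
residuated, the `V`-colimit is an `(L,V)`-colimit (`VQuantale.hom_prod_map`), which gives density.

The same lemma gives both halves of the injective hull: left Kan extensions into a `V`-quantale are
`(L,V)`-functors, so `hull B` is injective (`VQuantale.isInjective`), and it expresses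
`Q(q₁ * ⋯ * qₙ, q)` through values on `X`, so `i` is essential (`isEssential_of_hom`). The hull in
`V`-quantum B-algebras is the same, because these form a full subcategory of `(L,V)`-categories
(`isQBMorphism_iff_isLVFunctor`) in which a `V`-quantale has its usual `(L,V)`-structure
(`VQuantale.toQB_toLVCat`).
-/

set_option linter.unusedSectionVars false

namespace QEnr

variable {V : Type u} [CommMonoid V] [CompleteLattice V] [IsQuantale V]

/-! ### Weighted infima and representable weights -/

theorem mul_ihom_le (a b : V) : a * ihom a b ≤ b :=
  le_ihom.1 le_rfl

theorem LVCat.ext_hom {X : Type v} {A B : LVCat V X} (h : ∀ xs x, A.hom xs x = B.hom xs x) :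
    A = B := by
  have h' : A.hom = B.hom := funext₂ h
  cases A
  cases B
  cases h'
  rfl

/-- The weight of the limits in `IsDense.lim` is representable: `i^* · q_* = a(q, i -)`. -/
theorem relComp_lowerStar_upperStar {X : Type v} {Y : Type v'} {Z : Type w} (A : VCat V Y)
    (g : Z → Y) (f : X → Y) (z : Z) (x : X) :
    relComp (lowerStar A g) (upperStar A f) z x = A.hom (g z) (f x) :=
  A.iSup_hom_mul (fun y => A.hom y (f x)) _ fun _ => A.comp _ _ _

theorem listExt_map {X : Type v} {Y : Type v'} {Z : Type w} (r : Y → Z → V) (f : X → Y)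
    (xs : List X) (zs : List Z) :
    listExt r (xs.map f) zs = listExt (fun x z => r (f x) z) xs zs := by
  induction xs generalizing zs with
  | nil => cases zs <;> rfl
  | cons x xs ih =>
    cases zs with
    | nil => rfl
    | cons z zs => simp only [List.map_cons, listExt, ih]

theorem listExt_map_right {X : Type v} {Y : Type v'} {Z : Type w} (r : X → Z → V) (g : Y → Z)
    (xs : List X) (ys : List Y) :
    listExt r xs (ys.map g) = listExt (fun x y => r x (g y)) xs ys := by
  induction xs generalizing ys with
  | nil => cases ys <;> rfl
  | cons x xs ih =>
    cases ys with
    | nil => rfl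
    | cons y ys => simp only [List.map_cons, listExt, ih]

theorem listExt_mono {X : Type v} {Y : Type v'} {r s : X → Y → V} (h : ∀ x y, r x y ≤ s x y)
    (xs : List X) (ys : List Y) : listExt r xs ys ≤ listExt s xs ys := by
  induction xs generalizing ys with
  | nil => cases ys <;> exact le_rfl
  | cons x xs ih =>
    cases ys with
    | nil => exact le_rfl
    | cons y ys => exact mul_le_mul' (h x y) (ih ys)

theorem LVCat.comp_singleton {X : Type v} (A : LVCat V X) (xs : List X) (y z : X) :
    A.hom xs y * A.hom [y] z ≤ A.hom xs z := by
  simpa [listExt] using A.comp' [xs] [y] z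

/-- The weight of the colimits in `IsDense.colim`: `q^⊛ ∘ i_⊛ = a(L i -, q)`. -/
theorem kleisliComp_lowerLStar_upperLStar {X : Type v} {Y : Type v'} {Z : Type w}
    (A : LVCat V Y) (f : X → Y) (g : Z → Y) (xs : List X) (z : Z) :
    kleisliComp (lowerLStar A f) (upperLStar A g) xs z = A.hom (xs.map f) (g z) := by
  apply le_antisymm
  · revert xs z
    rw [kleisliComp_le_iff]
    intro xss ys z
    rw [List.map_flatten]
    exact le_of_eq_of_le (congrArg (· * _) (listExt_map A.hom (List.map f) xss ys).symm)
      (A.comp' _ _ _)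
  · refine le_trans ?_ (le_iSup _ (xs.map f))
    refine le_trans ?_ (mul_le_mul_left (le_iSup₂_of_le (xs.map fun x => [x])
      (flatten_map_singleton xs) ?_) _) (b := 1 * A.hom (xs.map f) (g z))
    · rw [one_mul]
    · induction xs with
      | nil => simp [listExt]
      | cons x xs ih => simpa [listExt, lowerLStar] using mul_le_mul' (A.one_le (f x)) ih

/-! ### `V`-quantum B-algebras as `(L,V)`-categories -/

namespace VQuantumBAlg

variable {X : Type v} (B : VQuantumBAlg V X)

theorem multiHom_congr {y z : X} (h : ∀ c, B.hom c y = B.hom c z) (xs : List X) :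
    B.toLVCat.hom xs y = B.toLVCat.hom xs z := by
  have key : ∀ y z : X, 1 ≤ B.hom y z → B.toLVCat.hom xs y ≤ B.toLVCat.hom xs z := by
    intro y z h
    exact (le_mul_of_one_le_right' h).trans (B.multiHom_comp xs y z)
  exact le_antisymm (key _ _ (by rw [← h]; exact B.one_le y))
    (key _ _ (by rw [h]; exact B.one_le z))

theorem toLVCat_nil (y : X) : B.toLVCat.hom [] y = B.hom B.unit y :=
  B.J_eq y

theorem toLVCat_cons (x : X) (xs : List X) (y : X) :
    B.toLVCat.hom (x :: xs) y = B.toLVCat.hom xs (B.limp x y) := by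
  refine (B.multiHom_cons x xs y).trans (le_antisymm (iSup_le fun c => ?_) ?_)
  · rw [B.P_limp]
    exact B.multiHom_comp _ _ _
  · refine le_trans ?_ (le_iSup _ (B.limp x y))
    rw [B.P_limp]
    exact le_mul_of_one_le_right' (B.one_le _)

/-- The associativity of `P` expresses that the two residuals commute. -/
theorem hom_limp_rimp (a b c d : X) :
    B.hom b (B.limp a (B.rimp c d)) = B.hom b (B.rimp c (B.limp a d)) := by
  have h := B.assoc a b c d
  have h1 : (⨆ x, B.P a b x * B.P x c d) = B.P a b (B.rimp c d) := by
    refine le_antisymm (iSup_le fun x => ?_) (le_trans ?_ (le_iSup _ (B.rimp c d)))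
    · rw [B.P_rimp c x]
      exact B.P_comp _ _ _ _
    · rw [B.P_rimp c]
      exact le_mul_of_one_le_right' (B.one_le _)
  have h2 : (⨆ x, B.P a x d * B.P b c x) = B.P b c (B.limp a d) := by
    refine le_antisymm (iSup_le fun x => ?_) (le_trans ?_ (le_iSup _ (B.limp a d)))
    · rw [B.P_limp a x, mul_comm]
      exact B.P_comp _ _ _ _
    · rw [B.P_limp a]
      exact le_mul_of_one_le_left' (B.one_le _)
  rw [h1, h2, B.P_limp, B.P_rimp] at h
  exact h

theorem toLVCat_concat (xs : List X) (x y : X) :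
    B.toLVCat.hom (xs ++ [x]) y = B.toLVCat.hom xs (B.rimp x y) := by
  induction xs generalizing y with
  | nil =>
    rw [toLVCat_nil, ← B.P_rimp]
    refine (B.unit_left x y).symm.trans (le_antisymm (iSup_le fun z => ?_) ?_)
    · rw [B.J_eq, B.P_rimp, B.P_rimp]
      exact B.comp _ _ _
    · refine le_trans ?_ (le_iSup _ B.unit)
      rw [B.J_eq]
      exact le_mul_of_one_le_left' (B.one_le _)
  | cons z xs ih =>
    rw [List.cons_append, toLVCat_cons, toLVCat_cons, ih]
    exact B.multiHom_congr (fun c => (B.hom_limp_rimp z c x y).symm) xs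

theorem exists_toLVCat_append_left (xs : List X) (y : X) :
    ∃ r, ∀ zs, B.toLVCat.hom (xs ++ zs) y = B.toLVCat.hom zs r := by
  induction xs generalizing y with
  | nil => exact ⟨y, fun _ => rfl⟩
  | cons x xs ih =>
    obtain ⟨r, hr⟩ := ih (B.limp x y)
    exact ⟨r, fun zs => by rw [List.cons_append, toLVCat_cons, hr]⟩

theorem exists_toLVCat_append_right (zs : List X) (y : X) :
    ∃ r, ∀ xs, B.toLVCat.hom (xs ++ zs) y = B.toLVCat.hom xs r := by
  induction zs with
  | nil => exact ⟨y, fun xs => by rw [List.append_nil]⟩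
  | cons z zs ih =>
    obtain ⟨r, hr⟩ := ih
    exact ⟨B.rimp z r, fun xs => by rw [← toLVCat_concat, ← hr, List.append_assoc]; rfl⟩

end VQuantumBAlg

/-- The category of `V`-quantum B-algebras is a full subcategory of that of `(L,V)`-categories. -/
theorem isQBMorphism_iff_isLVFunctor {X : Type v} {Y : Type v'} {A : VQuantumBAlg V X}
    {B : VQuantumBAlg V Y} {f : X → Y} :
    IsQBMorphism A B f ↔ IsLVFunctor A.toLVCat B.toLVCat f := by
  constructor
  · intro hf xs
    induction xs with
    | nil =>
      intro y
      rw [List.map_nil, A.toLVCat_nil, B.toLVCat_nil]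
      exact (hf.functor _ _).trans (VCat.hom_le_of_le_left hf.unit_le)
    | cons x xs ih =>
      intro y
      rw [List.map_cons, A.toLVCat_cons, B.toLVCat_cons]
      exact (ih _).trans
        ((le_mul_of_one_le_right' (hf.limp_le x y)).trans (B.multiHom_comp _ _ _))
  · intro hf
    refine ⟨fun x y => hf [x] y, fun x y => ?_, fun x y => ?_, ?_⟩
    · have h := hf [A.rimp x y, x] y
      have h1 : A.toLVCat.hom [A.rimp x y, x] y = A.hom (A.rimp x y) (A.rimp x y) :=
        A.P_rimp _ _ _
      have h2 : B.toLVCat.hom [f (A.rimp x y), f x] (f y) =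
        B.hom (f (A.rimp x y)) (B.rimp (f x) (f y)) := B.P_rimp _ _ _
      rw [h1] at h
      exact (A.one_le _).trans (h.trans h2.le)
    · have h := hf [x, A.limp x y] y
      have h1 : A.toLVCat.hom [x, A.limp x y] y = A.hom (A.limp x y) (A.limp x y) :=
        A.P_limp _ _ _
      have h2 : B.toLVCat.hom [f x, f (A.limp x y)] (f y) =
        B.hom (f (A.limp x y)) (B.limp (f x) (f y)) := B.P_limp _ _ _
      rw [h1] at h
      exact (A.one_le _).trans (h.trans h2.le)
    · have h := hf [] A.unit
      rw [List.map_nil, A.toLVCat_nil, B.toLVCat_nil] at h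
      exact (A.one_le _).trans h

/-- The two ways of regarding a `V`-quantale as an `(L,V)`-category agree. -/
theorem VQuantale.toQB_toLVCat {X : Type v} (Q : VQuantale V X) :
    Q.toQB.toLVCat = Q.toLVCat := by
  refine LVCat.ext_hom fun xs => ?_
  induction xs with
  | nil => exact Q.toQB.toLVCat_nil
  | cons x xs ih =>
    intro y
    rw [Q.toQB.toLVCat_cons, ih]
    exact Q.hom_limp x _ y

/-! ### Colimits and injectivity in `V`-quantales -/

/-- In a `V`-quantale, a `V`-colimit of products of values of `g` is an `(L,V)`-colimit of `g`,
since the multiplication is residuated. -/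
theorem VQuantale.hom_prod_map {X : Type v} {Y : Type v'} {Z : Type w} (Q : VQuantale V X)
    {j : List Y → Z → V} {g : Y → X} {h : Z → X}
    (H : ∀ z q, Q.hom (h z) q = ⨅ ys, ihom (j ys z) (Q.hom (Q.prod (ys.map g)) q))
    (zs : List Z) (q : X) :
    Q.hom (Q.prod (zs.map h)) q =
      ⨅ ys, ihom (listHat j ys zs) (Q.hom (Q.prod (ys.map g)) q) := by
  refine eq_of_forall_le_iff fun c => ?_
  simp only [listHat, le_iInf_iff, le_ihom, iSup_mul', iSup_le_iff]
  have main : c ≤ Q.hom (Q.prod (zs.map h)) q ↔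
      ∀ yss, listExt j yss zs * c ≤ Q.hom (Q.prod (yss.flatten.map g)) q := by
    induction zs generalizing c q with
    | nil =>
      constructor
      · rintro hc (_ | _)
        · simpa [listExt] using hc
        · simp [listExt, Quantale.bot_mul]
      · intro hc
        simpa [listExt] using hc []
    | cons z zs ih =>
      have h1 : Q.prod ((z :: zs).map h) = Q.mul (h z) (Q.prod (zs.map h)) := rfl
      have h2 : ∀ ys, c * j ys z ≤ Q.hom (Q.prod (zs.map h)) (Q.limp (Q.prod (ys.map g)) q) ↔
          ∀ yss, listExt j (ys :: yss) (z :: zs) * c ≤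
            Q.hom (Q.prod ((ys :: yss).flatten.map g)) q := by
        intro ys
        rw [ih]
        refine forall_congr' fun yss => ?_
        rw [Q.hom_limp, ← Q.prod_append, List.flatten_cons, List.map_append, listExt,
          ← mul_assoc, mul_comm (listExt j yss zs * c), ← mul_assoc]
      rw [h1, ← Q.hom_rimp, H, le_iInf_iff]
      simp only [le_ihom, Q.hom_rimp, ← Q.hom_limp]
      constructor
      · rintro hc (_ | ⟨ys, yss⟩)
        · simp [listExt, Quantale.bot_mul]
        · exact (h2 ys).1 (by rw [mul_comm]; exact hc ys) yss
      · intro hc ys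
        rw [mul_comm]
        exact (h2 ys).2 fun yss => hc _
  rw [main]
  exact ⟨fun hc _ yss hy => hy ▸ hc yss, fun hc yss => hc _ yss rfl⟩

/-- A `V`-quantale with weighted colimits of families in a given universe is injective: the left
Kan extension `h z = ⋁ C(L f ys, z) · g y₁ * ⋯ * g yₙ` of `g` along a fully faithful `f` is an
`(L,V)`-functor that extends `g`. -/
theorem VQuantale.isInjective {X : Type v} (Q : VQuantale V X)
    (hQ : ∀ (ι : Type w₁) (k : ι → V) (F : ι → X),
      ∃ s, ∀ q, Q.hom s q = ⨅ i, ihom (k i) (Q.hom (F i) q)) :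
    IsInjective.{u, v, w₁, w₂} Q.toLVCat := by
  intro Y Z B C f g hf hg
  choose h H using fun z => hQ (List Y) (fun ys => C.hom (ys.map f) z)
    (fun ys => Q.prod (ys.map g))
  -- the components of the colimit cocone
  have hcone : ∀ (ys : List Y) (z : Z), C.hom (ys.map f) z ≤ Q.hom (Q.prod (ys.map g)) (h z) := by
    intro ys z
    have h1 := Q.one_le (h z)
    rw [H, le_iInf_iff] at h1
    simpa [le_ihom] using h1 ys
  refine ⟨h, fun zs z => ?_, fun y => VCat.eq_of_hom Q.separated fun q => ?_⟩
  · refine le_of_le_of_eq ?_ (Q.hom_prod_map H zs (h z)).symm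
    refine le_iInf fun ys => le_ihom.2 ?_
    simp only [listHat, iSup_mul', iSup_le_iff]
    rintro yss rfl
    refine le_trans ?_ (hcone _ z)
    rw [List.map_flatten]
    rw [← listExt_map C.hom (List.map f)]
    exact C.comp' _ zs z
  · rw [H]
    apply le_antisymm
    · refine iInf_le_of_le [y] ?_
      have h1 : ihom (C.hom ([y].map f) (f y)) (Q.hom (Q.prod ([y].map g)) q) ≤
          Q.hom (Q.prod ([y].map g)) q :=
        (le_mul_of_one_le_left' (C.one_le (f y))).trans (mul_ihom_le _ _)
      simpa [MonoidalVCat.prod, Q.mul_unit] using h1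
    · refine le_iInf fun ys => le_ihom.2 ?_
      rw [← hf]
      exact (mul_le_mul_left (hg ys y) _).trans (Q.comp _ _ _)

/-! ### Density and essential maps -/

section Dense

variable {X : Type v} {Y : Type v'} {A : LVCat V X} {Q : VQuantale V Y} {i : X → Y}

/-- For density it suffices that every `q` is a `V`-limit and a `V`-colimit; the latter is then
an `(L,V)`-colimit by `VQuantale.hom_prod_map`. -/
theorem isDense_of_hom (hi : IsFullyFaithful A Q.toLVCat i)
    (hlim : ∀ p q, Q.hom p q = ⨅ x, ihom (Q.hom q (i x)) (Q.hom p (i x)))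
    (hcolim : ∀ q p, Q.hom q p =
      ⨅ xs : List X, ihom (Q.hom (Q.prod (xs.map i)) q) (Q.hom (Q.prod (xs.map i)) p)) :
    IsDense A Q i where
  fullyFaithful := hi
  lim q := by
    refine ⟨fun _ _ => Q.one_le q, fun p z => ?_⟩
    simp only [relComp_lowerStar_upperStar]
    exact hlim p q
  colim q := by
    refine ⟨fun zs z => ?_, fun zs p => ?_⟩
    · match zs with
      | [] => exact bot_le
      | _ :: _ :: _ => exact bot_le
      | [_] => exact Q.toLVCat.one_le q
    · refine Q.hom_prod_map (fun z p => ?_) zs p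
      simp only [kleisliComp_lowerLStar_upperLStar]
      exact hcolim q p

/-- A fully faithful `i` of which every `q` is a `V`-limit and a `V`-colimit is essential: the
values `Q(q₁ * ⋯ * qₙ, q)` are infima of expressions
`[q₁(xs₁) ⊗ ⋯ ⊗ qₙ(xsₙ) ⊗ Q(q, i x), A(xs₁ ⋯ xsₙ, x)]`, each of which is bounded below by
`C((f q₁, …, f qₙ), f q)` if `f i` is fully faithful. -/
theorem isEssential_of_hom (hi : IsFullyFaithful A Q.toLVCat i)
    (hlim : ∀ p q, Q.hom p q = ⨅ x, ihom (Q.hom q (i x)) (Q.hom p (i x)))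
    (hcolim : ∀ q p, Q.hom q p =
      ⨅ xs : List X, ihom (Q.hom (Q.prod (xs.map i)) q) (Q.hom (Q.prod (xs.map i)) p)) :
    IsEssential.{u, v, v', w} A Q.toLVCat i := by
  intro Z C f hf hfi qs q
  refine le_antisymm (hf qs q) (le_of_le_of_eq ?_ (hlim (Q.prod qs) q).symm)
  refine le_iInf fun x => le_ihom.2 ?_
  have h := Q.hom_prod_map (h := fun q => q) hcolim qs (i x)
  rw [List.map_id'] at h
  rw [h]
  refine le_iInf fun xs => le_ihom.2 ?_
  simp only [listHat, iSup_mul', iSup_le_iff]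
  rintro xss rfl
  have h1 : listExt (fun xs q => Q.hom (Q.prod (xs.map i)) q) xss qs ≤
      listExt C.hom (xss.map (List.map fun x => f (i x))) (qs.map f) := by
    rw [listExt_map, listExt_map_right]
    refine listExt_mono (fun xs q => ?_) _ _
    have := hf (xs.map i) q
    rwa [List.map_map] at this
  have h2 : Q.hom q (i x) ≤ C.hom [f q] (f (i x)) := by
    refine le_trans ?_ (hf [q] (i x))
    simp [MonoidalVCat.toLVCat, MonoidalVCat.prod, Q.mul_unit]
  refine le_of_le_of_eq ?_ ((hfi xss.flatten x).symm.trans (hi xss.flatten x))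
  rw [mul_comm (Q.hom q (i x)), ← mul_assoc, List.map_flatten]
  exact (mul_le_mul' ((mul_le_mul_left h1 _).trans (C.comp' _ _ _)) h2).trans
    (C.comp_singleton _ _ _)

end Dense

/-! ### The closure of a presheaf under representables -/

section Closure

variable {X : Type v} (A : LVCat V X)

/-- The `V`-limit of the Yoneda embedding weighted by `x ↦ D_L(X)(φ, y x)`, computed pointwise:
the meet of all representables above `φ`, in the `V`-enriched sense. -/
def repClosure (φ : Presheaf A) : Presheaf A :=
  ⟨fun xs => ⨅ x, ihom ((presheafVCat A).hom φ (yoneda A x)) (A.hom xs x), by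
    rw [isPresheaf_iff']
    intro xss ys
    refine le_iInf fun x => le_ihom.2 ?_
    rw [mul_left_comm]
    refine le_trans (mul_le_mul_right ?_ _) (A.comp' xss ys x)
    exact (mul_le_mul_right (iInf_le _ x) _).trans (mul_ihom_le _ _)⟩

theorem hom_repClosure (ψ φ : Presheaf A) :
    (presheafVCat A).hom ψ (repClosure A φ) =
      ⨅ x, ihom ((presheafVCat A).hom φ (yoneda A x)) ((presheafVCat A).hom ψ (yoneda A x)) := by
  refine eq_of_forall_le_iff fun c => ?_
  simp only [le_presheaf_hom, repClosure, yoneda, le_iInf_iff, le_ihom]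
  rw [forall_comm]
  refine forall_congr' fun x => forall_congr' fun xs => ?_
  rw [mul_left_comm]

theorem le_repClosure (φ : Presheaf A) :
    1 ≤ (presheafVCat A).hom φ (repClosure A φ) := by
  rw [hom_repClosure]
  exact le_iInf fun x => le_ihom.2 (mul_one _).le

theorem hom_repClosure_yoneda (φ : Presheaf A) (x : X) :
    (presheafVCat A).hom (repClosure A φ) (yoneda A x) =
      (presheafVCat A).hom φ (yoneda A x) := by
  refine le_antisymm (VCat.hom_le_of_le_left (le_repClosure A φ)) ?_
  have h := (presheafVCat A).one_le (repClosure A φ)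
  rw [hom_repClosure, le_iInf_iff] at h
  simpa [le_ihom] using h x

/-- Weighted limits of representables are fixed by the closure. -/
theorem repClosure_eq_self {ι : Type w} {ψ : Presheaf A} (k : ι → V) (r : ι → X)
    (hψ : ∀ xs, ψ.1 xs = ⨅ i, ihom (k i) (A.hom xs (r i))) : repClosure A ψ = ψ := by
  refine presheaf_separated A _ _ (le_presheaf_hom.2 fun xs => ?_) (le_repClosure A ψ)
  rw [mul_one, hψ]
  refine le_iInf fun i => le_ihom.2 ?_
  have h : k i ≤ (presheafVCat A).hom ψ (yoneda A (r i)) := by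
    rw [le_presheaf_hom]
    intro ys
    rw [hψ, mul_comm]
    exact (mul_le_mul_right (iInf_le _ i) _).trans (mul_ihom_le _ _)
  exact (mul_le_mul' h (iInf_le _ (r i))).trans (mul_ihom_le _ _)

theorem repClosure_idem (φ : Presheaf A) : repClosure A (repClosure A φ) = repClosure A φ :=
  repClosure_eq_self A _ id fun _ => rfl

theorem repClosure_yoneda (x : X) : repClosure A (yoneda A x) = yoneda A x := by
  refine repClosure_eq_self A (fun _ : Unit => 1) (fun _ => x) fun xs => ?_
  rw [iInf_const]
  refine eq_of_forall_le_iff fun c => ?_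
  rw [le_ihom, one_mul]
  rfl

theorem repClosure_functor :
    IsVFunctor (presheafVCat A) (presheafVCat A) (repClosure A) := by
  intro φ ψ
  rw [hom_repClosure]
  refine le_iInf fun x => le_ihom.2 ?_
  rw [hom_repClosure_yoneda, mul_comm]
  exact (presheafVCat A).comp _ _ _

theorem hom_repClosure_left (φ : Presheaf A) {ψ : Presheaf A} (hψ : repClosure A ψ = ψ) :
    (presheafVCat A).hom (repClosure A φ) ψ = (presheafVCat A).hom φ ψ := by
  rw [← hψ, hom_repClosure, hom_repClosure]
  simp only [hom_repClosure_yoneda]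

/-- `D_L(X)` has weighted colimits of families indexed by types of any universe. -/
theorem exists_presheaf_colimit {ι : Type w} (k : ι → V) (F : ι → Presheaf A) :
    ∃ s : Presheaf A, ∀ ψ, (presheafVCat A).hom s ψ =
      ⨅ i, ihom (k i) ((presheafVCat A).hom (F i) ψ) := by
  refine ⟨⟨fun xs => ⨆ i, k i * (F i).1 xs, ?_⟩, fun ψ => eq_of_forall_le_iff fun c => ?_⟩
  · rw [isPresheaf_iff']
    intro xss xs
    rw [mul_iSup']
    refine iSup_mono fun i => ?_
    rw [mul_left_comm]
    exact mul_le_mul_right (isPresheaf_iff'.1 (F i).2 _ _) _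
  · simp only [le_presheaf_hom, le_iInf_iff, le_ihom, iSup_mul', iSup_le_iff]
    rw [forall_comm]
    refine forall_congr' fun i => forall_congr' fun xs => ?_
    rw [mul_comm (k i), mul_assoc]

end Closure

/-! ### The closure on a `V`-quantum B-algebra -/

section QuantumBAlg

variable {X : Type v} (B : VQuantumBAlg V X)

theorem repClosure_convRimp (φ : Presheaf B.toLVCat) (x : X) :
    repClosure B.toLVCat (convRimp φ (yoneda B.toLVCat x)) =
      convRimp φ (yoneda B.toLVCat x) := by
  choose r hr using fun zs => B.exists_toLVCat_append_right zs x
  exact repClosure_eq_self _ φ.1 r fun xs => iInf_congr fun zs => congrArg _ (hr zs xs)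

theorem repClosure_convLimp (φ : Presheaf B.toLVCat) (x : X) :
    repClosure B.toLVCat (convLimp φ (yoneda B.toLVCat x)) =
      convLimp φ (yoneda B.toLVCat x) := by
  choose r hr using fun ys => B.exists_toLVCat_append_left ys x
  exact repClosure_eq_self _ φ.1 r fun xs => iInf_congr fun ys => congrArg _ (hr ys xs)

/-- The residuals of a representable by an arbitrary presheaf are limits of representables, so
that the closure is compatible with convolution. -/
theorem repClosure_isLaxMonoidalMonad :
    IsLaxMonoidalMonad (presheafQuantale B.toLVCat) (repClosure B.toLVCat) where
  functor := repClosure_functor _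
  le := le_repClosure _
  unit_le := le_repClosure _ _
  idem := repClosure_idem _
  mul_le φ ψ := by
    have h : ∀ x, (presheafVCat B.toLVCat).hom
        (conv (repClosure B.toLVCat φ) (repClosure B.toLVCat ψ)) (yoneda B.toLVCat x) =
          (presheafVCat B.toLVCat).hom (conv φ ψ) (yoneda B.toLVCat x) := fun x => by
      rw [hom_convRimp, hom_repClosure_left _ _ (repClosure_convRimp B _ x), ← hom_convRimp,
        hom_convLimp, hom_repClosure_left _ _ (repClosure_convLimp B _ x), ← hom_convLimp]
    refine le_of_le_of_eq ?_ (hom_repClosure _ _ _).symm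
    refine le_iInf fun x => le_ihom.2 ?_
    rw [mul_one]
    exact (h x).ge

/-- The `V`-quantale of presheaves that are limits of representables. -/
abbrev hull : VQuantale V {φ : Presheaf B.toLVCat // repClosure B.toLVCat φ = φ} :=
  (presheafQuantale B.toLVCat).fixedPoints _ (repClosure_isLaxMonoidalMonad B)

/-- The Yoneda embedding, corestricted to `hull B`. -/
def hullEmb (x : X) : {φ : Presheaf B.toLVCat // repClosure B.toLVCat φ = φ} :=
  ⟨yoneda B.toLVCat x, repClosure_yoneda _ x⟩

/-- The embedding preserves the residual: `i x ◁ i y = i (x ◁ y)`, tested against `hom q -`. -/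
theorem hull_hom_mul_hullEmb (x y : X)
    (q : {φ : Presheaf B.toLVCat // repClosure B.toLVCat φ = φ}) :
    (hull B).hom ((hull B).mul (hullEmb B x) q) (hullEmb B y) =
      (hull B).hom q (hullEmb B (B.limp x y)) := by
  refine (hom_repClosure_left _ _ (repClosure_yoneda _ y)).trans ?_
  refine eq_of_forall_le_iff fun c => ?_
  refine (le_presheaf_hom.trans conv_mul_le).trans (Iff.trans ?_ le_presheaf_hom.symm)
  simp only [yoneda, hullEmb, ← B.toLVCat_cons]
  constructor
  · intro h zs
    -- the unit law of the structure, at the one-element list `[x]`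
    refine le_trans ?_ (h [x] zs)
    rw [mul_assoc]
    exact le_mul_of_one_le_left' (B.toLVCat.one_le x)
  · intro h ys zs
    rw [mul_assoc]
    refine (mul_le_mul_right (h zs) _).trans ?_
    -- with `a(- ++ zs, y) = a(-, r)` this is composition of `a(ys, x)` with `a([x], r)`
    obtain ⟨r, hr⟩ := B.exists_toLVCat_append_right zs y
    rw [hr, show x :: zs = [x] ++ zs from rfl, hr]
    exact B.toLVCat.comp_singleton _ _ _

theorem hullEmb_isFullyFaithful :
    IsFullyFaithful B.toLVCat (hull B).toLVCat (hullEmb B) := by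
  intro xs
  induction xs with
  | nil =>
    intro y
    refine Eq.symm ((hom_repClosure_left _ _ (repClosure_yoneda _ y)).trans ?_)
    refine eq_of_forall_le_iff fun c => le_presheaf_hom.trans ?_
    simp [presheafQuantale, unitPresheaf, iSup_mul', yoneda]
  | cons x xs ih =>
    intro y
    rw [B.toLVCat_cons, ih]
    exact (hull_hom_mul_hullEmb B x y _).symm

/-- Every `q` in the hull is the limit of `i` weighted by `x ↦ Q(q, i x)`. -/
theorem hull_hom_eq_iInf (p q : {φ : Presheaf B.toLVCat // repClosure B.toLVCat φ = φ}) :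
    (hull B).hom p q =
      ⨅ x, ihom ((hull B).hom q (hullEmb B x)) ((hull B).hom p (hullEmb B x)) := by
  refine Eq.trans ?_ (hom_repClosure B.toLVCat p.1 q.1)
  rw [q.2]
  rfl

/-- The Yoneda lemma for lists of representables. -/
theorem hull_hom_prod_hullEmb (xs : List X)
    (q : {φ : Presheaf B.toLVCat // repClosure B.toLVCat φ = φ}) :
    (hull B).hom ((hull B).prod (xs.map (hullEmb B))) q = q.1.1 xs := by
  rw [hull_hom_eq_iInf]
  refine Eq.trans ?_ (congrArg (fun φ : Presheaf B.toLVCat => φ.1 xs) q.2)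
  exact iInf_congr fun x => congrArg _ (hullEmb_isFullyFaithful B xs x).symm

/-- Every `q` in the hull is the `V`-colimit of the products `i x₁ * ⋯ * i xₙ`, weighted by their
homs into `q`. -/
theorem hull_hom_eq_iInf_prod (q p : {φ : Presheaf B.toLVCat // repClosure B.toLVCat φ = φ}) :
    (hull B).hom q p = ⨅ xs : List X,
      ihom ((hull B).hom ((hull B).prod (xs.map (hullEmb B))) q)
        ((hull B).hom ((hull B).prod (xs.map (hullEmb B))) p) := by
  simp only [hull_hom_prod_hullEmb]
  rfl

theorem hull_isInjective : IsInjective.{u, max u v, w₁, w₂} (hull B).toLVCat := by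
  refine (hull B).isInjective fun ι k F => ?_
  obtain ⟨s, hs⟩ := exists_presheaf_colimit B.toLVCat k fun i => (F i).1
  exact ⟨⟨repClosure B.toLVCat s, repClosure_idem _ s⟩, fun q =>
    (hom_repClosure_left _ s q.2).trans (hs q.1)⟩

theorem hullEmb_isInjectiveHull :
    IsInjectiveHull.{u, v, max u v, w₁, w₂, w₃} B.toLVCat (hull B).toLVCat (hullEmb B) :=
  ⟨hullEmb_isFullyFaithful B, hull_isInjective B,
    isEssential_of_hom (hullEmb_isFullyFaithful B) (hull_hom_eq_iInf B)
      (hull_hom_eq_iInf_prod B)⟩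

/-- An injective hull of `(L,V)`-categories between `V`-quantum B-algebras is one in the full
subcategory of `V`-quantum B-algebras, where the extension and essentiality properties are tested
on fewer objects. -/
theorem IsInjectiveHull.isQBInjectiveHull {Y : Type v'} {D : VQuantumBAlg V Y} {e : X → Y}
    (h : IsInjectiveHull.{u, v, v', w₁, w₂, w₃} B.toLVCat D.toLVCat e) :
    IsQBInjectiveHull.{u, v, v', w₁, w₂, w₃} B D e := by
  refine ⟨isQBMorphism_iff_isLVFunctor.2 fun xs y => (h.1 xs y).le, h.1, ?_, ?_⟩
  · intro Y Z B C f g _ hff hg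
    obtain ⟨k, hk, hkf⟩ := h.2.1 Y Z _ _ f g hff (isQBMorphism_iff_isLVFunctor.1 hg)
    exact ⟨k, isQBMorphism_iff_isLVFunctor.2 hk, hkf⟩
  · intro Z C f hf hff
    exact h.2.2 Z _ f (isQBMorphism_iff_isLVFunctor.1 hf) hff

end QuantumBAlg

end QEnr

theorem mainTheorem6 {V : Type u} [CommMonoid V] [CompleteLattice V] [IsQuantale V]
    {X : Type v} (B : QEnr.VQuantumBAlg V X) :
    ∃ T : QEnr.Presheaf B.toLVCat → QEnr.Presheaf B.toLVCat,
      (∀ φ, QEnr.IsLimit (QEnr.VCat.point.{u, 0} V) (QEnr.presheafQuantale B.toLVCat).toVCat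
        (QEnr.relComp
          (QEnr.lowerStar (QEnr.presheafQuantale B.toLVCat).toVCat fun _ => φ)
          (QEnr.upperStar (QEnr.presheafQuantale B.toLVCat).toVCat (QEnr.yoneda B.toLVCat)))
        (QEnr.yoneda B.toLVCat) (fun _ => T φ)) ∧
      ∃ (hT : QEnr.IsLaxMonoidalMonad (QEnr.presheafQuantale B.toLVCat) T)
        (i : X → {φ : QEnr.Presheaf B.toLVCat // T φ = φ}),
        (∀ x, (i x : QEnr.Presheaf B.toLVCat) = QEnr.yoneda B.toLVCat x) ∧
        QEnr.IsQBMorphism B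
          ((QEnr.presheafQuantale B.toLVCat).fixedPoints T hT).toQB i ∧
        QEnr.IsDense B.toLVCat ((QEnr.presheafQuantale B.toLVCat).fixedPoints T hT) i ∧
        QEnr.IsInjectiveHull.{u, v, max u v, w₁, w₂, w₃} B.toLVCat
          ((QEnr.presheafQuantale B.toLVCat).fixedPoints T hT).toLVCat i ∧
        QEnr.IsQBInjectiveHull.{u, v, max u v, w₁, w₂, w₃} B
          ((QEnr.presheafQuantale B.toLVCat).fixedPoints T hT).toQB i := by
  have hQB : QEnr.IsQBInjectiveHull.{u, v, max u v, w₁, w₂, w₃} B (QEnr.hull B).toQB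
      (QEnr.hullEmb B) := by
    refine QEnr.IsInjectiveHull.isQBInjectiveHull B ?_
    rw [QEnr.VQuantale.toQB_toLVCat]
    exact QEnr.hullEmb_isInjectiveHull B
  refine ⟨QEnr.repClosure B.toLVCat, fun φ => ⟨fun _ _ => ?_, fun ψ z => ?_⟩,
    QEnr.repClosure_isLaxMonoidalMonad B, QEnr.hullEmb B, fun x => rfl, hQB.1,
    QEnr.isDense_of_hom (QEnr.hullEmb_isFullyFaithful B) (QEnr.hull_hom_eq_iInf B)
      (QEnr.hull_hom_eq_iInf_prod B), QEnr.hullEmb_isInjectiveHull B, hQB⟩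
  · exact (QEnr.presheafVCat B.toLVCat).one_le _
  · simp only [QEnr.relComp_lowerStar_upperStar]
    exact QEnr.hom_repClosure B.toLVCat ψ φ
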